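/- Let $N\ge 1$ be an integer, $m>1$, $0<p<1$, $\sigma=\frac{2(1-p)}{m-1}$, and assume $m+p<2$. For real numbers $\alpha,\beta$ with $\alpha=\frac{2}{m-1}\beta$ consider $$ (f^m)''(\xi)+\frac{N-1}{\xi}(f^m)'(\xi)-\alpha f(\xi)+\beta\xi f'(\xi)+\xi^{\sigma}f(\xi)^p=0,\qquad \xi>0. \tag{ODE} $$ (1) (ODE) has no good profile with interface. That is, for no such $\alpha,\beta$ is there a function $f$ with $f(0)>0$, $f'(0)=0$ for which there is $\xi_0\in(0,\infty)$ such that $f$ is positive and solves (ODE) classically on $(0,\xi_0)$, $f(\xi_0)=0$, and $(f^m)'(\xi_0)=0$ (left derivative). (2) Correspondingly, the equation $u_t=\Delta u^m+|x|^{\sigma}u^p$ has no eternal exponential self-similar solution with an interface. That is, there is no function $u(x,t)=e^{\alpha t}f(|x|e^{-\beta t})$, $(x,t)\in\mathbb{R}^N\times\mathbb{R}$, with any real $\alpha,\beta$ and any continuous $f\ge 0$ on $[0,\infty)$ such that $f(0)>0$, $f'(0)=0$; for some $\xi_0\in(0,\infty)$, $f>0$ on $(0,\xi_0)$, $f(\xi_0)=0$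 and $(f^m)'(\xi_0)=0$ (left derivative); $f$ is $C^2$ on $\{\xi>0: f(\xi)>0\}$; and $u$ satisfies the equation at every point where $u>0$ and $x\ne0$. (3) If moreover $\alpha>0$, then every profile with $f(0)>0$, $f'(0)=0$ changes sign at a finite point. That is, if $f$ is a positive classical solution of (ODE) on $(0,R)$, $0<R\le\infty$, with $f(0)>0$, $f'(0)=0$, that cannot be continued as a positive solution to a larger interval, then $R=\xi_0<\infty$, $f(\xi)\to0$ and $(f^m)'(\xi)\to\ell$ for some $\ell<0$ as $\xi\to\xi_0^-$, and $f(\xi)\sim C(\xi_0-\xi)^{1/m}$ as $\xi\to\xi_0^-$ for some $C>0$; in particular every continuation $F$ of $f$ across $\xi_0$ with $|F|^{m-1}F$ differentiable at $\xi_0$ is negative immediately to the right of $\xi_0$. -/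

import Mathlib

open Set Filter Topology
open scoped Asymptotics

/-- `f` is a positive classical (`C²`) solution, on the open set `I ⊆ (0, ∞)`, of
`(f^m)'' + (N-1)/ξ (f^m)' - α f + β ξ f' + ξ^σ f^p = 0`. -/
def IsPositiveSolutionOn (N : ℕ) (m p σ α β : ℝ) (f : ℝ → ℝ) (I : Set ℝ) : Prop :=
  ContDiffOn ℝ 2 f I ∧ (∀ ξ ∈ I, 0 < f ξ) ∧
    ∀ ξ ∈ I,
      deriv (deriv (fun s => f s ^ m)) ξ + ((N : ℝ) - 1) / ξ * deriv (fun s => f s ^ m) ξ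
        - α * f ξ + β * ξ * deriv f ξ + ξ ^ σ * f ξ ^ p = 0

/-- The condition `f(0) = A > 0`, `f'(0) = 0` (one-sided derivative, since `ξ ≥ 0`). -/
def StartsFlat (f : ℝ → ℝ) : Prop :=
  0 < f 0 ∧ HasDerivWithinAt f 0 (Ici 0) 0

/-- The interface condition at `ξ₀`: `f > 0` on `(0, ξ₀)`, `f(ξ₀) = 0` and `(f^m)'(ξ₀) = 0`.
The derivative is taken from inside the positivity interval. -/
def HasInterfaceAt (m : ℝ) (f : ℝ → ℝ) (ξ₀ : ℝ) : Prop :=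
  (∀ ξ ∈ Ioo 0 ξ₀, 0 < f ξ) ∧ f ξ₀ = 0 ∧
    HasDerivWithinAt (fun s => f s ^ m) 0 (Iic ξ₀) ξ₀

/-- Good profile with interface. -/
def IsGoodProfile (N : ℕ) (m p σ α β : ℝ) (f : ℝ → ℝ) : Prop :=
  StartsFlat f ∧
    ∃ ξ₀ : ℝ, 0 < ξ₀ ∧ IsPositiveSolutionOn N m p σ α β f (Ioo 0 ξ₀) ∧ HasInterfaceAt m f ξ₀

/-- `u` is an eternal exponential self-similar solution with an interface of
`u_t = Δ(u^m) + |x|^σ u^p`: it is defined for all `x ∈ ℝ^N` and `t ∈ ℝ`, it has the form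
`u(x,t) = e^{αt} f(|x| e^{-βt})` for some real `α`, `β` and some continuous `f ≥ 0` with
`f(0) > 0`, `f'(0) = 0` and an interface at a point `ξ₀ ∈ (0, ∞)`, and it solves the equation
classically wherever `u > 0` and `x ≠ 0`. No relation between `α` and `β` and no sign of them
is required. -/
def IsEternalSolutionWithInterface (N : ℕ) (m p σ : ℝ)
    (u : EuclideanSpace ℝ (Fin N) → ℝ → ℝ) : Prop :=
  ∃ (α β : ℝ) (f : ℝ → ℝ),
    (∀ x t, u x t = Real.exp (α * t) * f (‖x‖ * Real.exp (-β * t))) ∧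
    ContinuousOn f (Ici 0) ∧ (∀ ξ, 0 ≤ ξ → 0 ≤ f ξ) ∧
    StartsFlat f ∧ (∃ ξ₀ : ℝ, 0 < ξ₀ ∧ HasInterfaceAt m f ξ₀) ∧
    ContDiffOn ℝ 2 f {ξ | 0 < ξ ∧ 0 < f ξ} ∧
    ∀ x t, x ≠ 0 → 0 < u x t →
      deriv (fun s => u x s) t =
        Laplacian.laplacian (fun y => u y t ^ m) x + ‖x‖ ^ σ * u x t ^ p

/-- The interval `(0, R)`, where `R` may be `∞`. -/
def openInterval (R : EReal) : Set ℝ := {ξ | 0 < ξ ∧ (ξ : EReal) < R}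

/-- `f` on `[0, R)`, `0 < R ≤ ∞`, is a maximal positive profile with `f(0) > 0`, `f'(0) = 0`:
it cannot be continued as a positive solution to any larger interval. -/
def IsMaximalProfile (N : ℕ) (m p σ α β : ℝ) (f : ℝ → ℝ) (R : EReal) : Prop :=
  0 < R ∧ StartsFlat f ∧ IsPositiveSolutionOn N m p σ α β f (openInterval R) ∧
    ∀ (g : ℝ → ℝ) (R' : EReal), R < R' → EqOn g f (openInterval R) →
      ¬ IsPositiveSolutionOn N m p σ α β g (openInterval R')

/-- `f`, positive to the left of `ξ₀`, changes sign at `ξ₀`: it reaches `0` there, `f^m` does so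
with strictly negative slope (so `f ∼ C (ξ₀ - ξ)^{1/m}`), and every continuation `F` of `f` across
`ξ₀` for which the signed power `|F|^{m-1} F` is differentiable at `ξ₀` is negative immediately
after `ξ₀`. -/
def ChangesSignAt (m : ℝ) (f : ℝ → ℝ) (ξ₀ : ℝ) : Prop :=
  (∀ ξ ∈ Ioo 0 ξ₀, 0 < f ξ) ∧
  Tendsto f (𝓝[<] ξ₀) (𝓝 0) ∧
  (∃ l : ℝ, l < 0 ∧ Tendsto (deriv (fun s => f s ^ m)) (𝓝[<] ξ₀) (𝓝 l)) ∧
  (∃ C : ℝ, 0 < C ∧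
    Asymptotics.IsEquivalent (𝓝[<] ξ₀) f (fun ξ => C * (ξ₀ - ξ) ^ (1 / m))) ∧
  ∀ F : ℝ → ℝ, EqOn F f (Ioo 0 ξ₀) →
    DifferentiableAt ℝ (fun ξ => |F ξ| ^ (m - 1) * F ξ) ξ₀ →
    ∀ᶠ ξ in 𝓝[>] ξ₀, F ξ < 0

/-! ### Calculus on intervals -/

/-! Put `w = f^m`. The core is that no positive solution can reach zero at a finite `b` with zero
flux (`IsPositiveSolutionOn.false_of_tendsto_zero_of_frequently`). The quantity `G = w' + (N-1)/ξ w
+ β ξ f` differs from `w'` by `O(f)`, and since `p < 1` the reaction dominates near `f = 0`, so `G'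
≤ -c f^p`. Zero flux forces `G > 0`. As `w` is nonincreasing near `b`, also `G ≤ C f`. Hence `G' ≤
-c' G^p`, and integration gives `G^(1-p) ≥ A (b - ξ)`. On the other hand `G > 0` gives `w' ≥ -C f`,
that is `f^(m-1) ≤ C' (b - ξ)`. Together, `b - ξ` is at most a constant times `f^(1-p) = f^(m-1)
f^(2-m-p)`, hence at most a constant times `f^(2-m-p) (b - ξ)`; this is absurd as `f → 0` because `m
+ p < 2`. This excludes interfaces for profiles, and for self-similar solutions after writing the
Laplacian in radial form.

For the sign change, let `k = 2/(m-1)`, so that `α = k β`, `k m = k + 2` and `σ = k (1-p)`. In the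
variables `φ = ξ^(-k) f`, `ψ = φ^m` and `s = log ξ` the equation is autonomous. Since `ψ` blows up
at the origin it decreases somewhere, and then forever, its critical points being strict maxima. A
global solution would have a flux `H` with `0 < H ≤ C φ` and `dH/ds ≤ -φ^p ≤ -c H^p`, so `H` would
die at a finite `s` (`not_isPositiveSolutionOn_Ioi`). So `R` is finite, and monotonicity of `ψ`
gives limits of `w` and `w'` at `R`. A positive limit of `w` would permit continuation by
Picard–Lindelöf. So `w → 0`, the slope is at most zero, and the core argument makes it nonzero. -/

theorem sub_le_mul_sub_of_hasDerivAt_le {h h' : ℝ → ℝ} {D : Set ℝ} (hD : Convex ℝ D) {C : ℝ}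
    (hd : ∀ x ∈ D, HasDerivAt h (h' x) x) (hC : ∀ x ∈ D, h' x ≤ C) {x y : ℝ} (hx : x ∈ D)
    (hy : y ∈ D) (hxy : x ≤ y) : h y - h x ≤ C * (y - x) := by
  refine hD.image_sub_le_mul_sub_of_deriv_le
    (fun z hz => (hd z hz).continuousAt.continuousWithinAt)
    (fun z hz => (hd z (interior_subset hz)).differentiableAt.differentiableWithinAt)
    (fun z hz => ?_) x hx y hy hxy
  rw [(hd z (interior_subset hz)).deriv]
  exact hC z (interior_subset hz)

theorem mul_sub_le_sub_of_le_hasDerivAt {h h' : ℝ → ℝ} {D : Set ℝ} (hD : Convex ℝ D) {C : ℝ}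
    (hd : ∀ x ∈ D, HasDerivAt h (h' x) x) (hC : ∀ x ∈ D, C ≤ h' x) {x y : ℝ} (hx : x ∈ D)
    (hy : y ∈ D) (hxy : x ≤ y) : C * (y - x) ≤ h y - h x := by
  have := sub_le_mul_sub_of_hasDerivAt_le (h := fun x => -h x) (h' := fun x => -h' x) (C := -C) hD
    (fun x hx => (hd x hx).neg) (fun x hx => neg_le_neg (hC x hx)) hx hy hxy
  linarith

/-- A function with bounded derivative on `(a, b)` has a left limit at `b`. -/
theorem exists_tendsto_nhdsLT_of_hasDerivAt_bounded {h h' : ℝ → ℝ} {a b K : ℝ} (hab : a < b)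
    (hd : ∀ x ∈ Ioo a b, HasDerivAt h (h' x) x) (hK : ∀ x ∈ Ioo a b, |h' x| ≤ K) :
    ∃ L, Tendsto h (𝓝[<] b) (𝓝 L) := by
  have hup : ∀ x ∈ Ioo a b, ∀ y ∈ Ioo a b, x ≤ y → h y - h x ≤ K * (y - x) :=
    fun x hx y hy hxy => sub_le_mul_sub_of_hasDerivAt_le (convex_Ioo a b) hd
      (fun z hz => (abs_le.1 (hK z hz)).2) hx hy hxy
  have hlow : ∀ x ∈ Ioo a b, ∀ y ∈ Ioo a b, x ≤ y → -K * (y - x) ≤ h y - h x :=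
    fun x hx y hy hxy => mul_sub_le_sub_of_le_hasDerivAt (convex_Ioo a b) hd
      (fun z hz => (abs_le.1 (hK z hz)).1) hx hy hxy
  have hc : (a + b) / 2 ∈ Ioo a b := ⟨by linarith, by linarith⟩
  have hK0 : 0 ≤ K := (abs_nonneg _).trans (hK _ hc)
  -- Subtracting a line of slope `K` makes `h` antitone, so the limit exists once a lower bound is
  -- known; the bound compares with the midpoint.
  have hanti : AntitoneOn (fun x => h x - K * x) (Ioo a b) := by
    intro x hx y hy hxy
    have := hup x hx y hy hxy
    simp only
    linarith
  have hbdd : BddBelow ((fun x => h x - K * x) '' Ioo a b) := by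
    refine ⟨h ((a + b) / 2) - K * (b - a) - K * b, ?_⟩
    rintro _ ⟨y, hy, rfl⟩
    simp only
    have h1 : K * y ≤ K * b := mul_le_mul_of_nonneg_left hy.2.le hK0
    rcases le_total ((a + b) / 2) y with hle | hle
    · have h2 := hlow _ hc y hy hle
      have h3 : K * (y - (a + b) / 2) ≤ K * (b - a) :=
        mul_le_mul_of_nonneg_left (by linarith [hy.2]) hK0
      linarith
    · have h2 := hup y hy _ hc hle
      have h3 : K * ((a + b) / 2 - y) ≤ K * (b - a) :=
        mul_le_mul_of_nonneg_left (by linarith [hy.1]) hK0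
      linarith
  have hlim := hanti.tendsto_nhdsWithin_Ioo_left ⟨_, hc⟩ hbdd
  have hid : Tendsto (fun x : ℝ => K * x) (𝓝[<] b) (𝓝 (K * b)) :=
    ((continuous_const.mul continuous_id).tendsto b).mono_left nhdsWithin_le_nhds
  exact ⟨_, (hlim.add hid).congr fun x => by simp⟩

/-- A function whose derivative is negative wherever it vanishes stays nonpositive. -/
theorem nonpos_of_hasDerivAt_neg_of_eq_zero {h h' : ℝ → ℝ} {a b : ℝ} (ha : h a ≤ 0)
    (hd : ∀ x ∈ Icc a b, HasDerivAt h (h' x) x) (hneg : ∀ x ∈ Icc a b, h x = 0 → h' x < 0) :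
    ∀ x ∈ Icc a b, h x ≤ 0 := by
  intro x hx
  exact image_le_of_deriv_right_lt_deriv_boundary (B := fun _ => 0) (B' := fun _ => 0)
    (fun z hz => (hd z hz).continuousAt.continuousWithinAt)
    (fun z hz => (hd z (Ico_subset_Icc_self hz)).hasDerivWithinAt) ha
    (fun z => hasDerivAt_const z _) (fun z hz => hneg z (Ico_subset_Icc_self hz)) hx

/-- Quantitative extinction for `G' ≤ -c G^p` with `p < 1`. -/
theorem mul_sub_le_rpow_of_hasDerivAt_le {G G' : ℝ → ℝ} {D : Set ℝ} {p c : ℝ} (hD : Convex ℝ D)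
    (hp1 : p < 1) (hpos : ∀ x ∈ D, 0 < G x) (hd : ∀ x ∈ D, HasDerivAt G (G' x) x)
    (hle : ∀ x ∈ D, G' x ≤ -c * G x ^ p) {x y : ℝ} (hx : x ∈ D) (hy : y ∈ D) (hxy : x ≤ y) :
    (1 - p) * c * (y - x) ≤ G x ^ (1 - p) := by
  have key := sub_le_mul_sub_of_hasDerivAt_le (h := fun x => G x ^ (1 - p)) (C := -((1 - p) * c))
    hD (fun z hz => (hd z hz).rpow_const (Or.inl (hpos z hz).ne')) (fun z hz => ?_) hx hy hxy
  · have := (Real.rpow_pos_of_pos (hpos y hy) (1 - p)).le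
    linarith
  · have h1 : G z ^ p * G z ^ (1 - p - 1) = 1 := by
      rw [← Real.rpow_add (hpos z hz)]; simp
    have h2 : 0 < G z ^ (1 - p - 1) := Real.rpow_pos_of_pos (hpos z hz) _
    calc G' z * (1 - p) * G z ^ (1 - p - 1)
        ≤ (-c * G z ^ p) * (1 - p) * G z ^ (1 - p - 1) :=
          mul_le_mul_of_nonneg_right
            (mul_le_mul_of_nonneg_right (hle z hz) (by linarith)) h2.le
      _ = -((1 - p) * c) * (G z ^ p * G z ^ (1 - p - 1)) := by ring
      _ = -((1 - p) * c) := by rw [h1, mul_one]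

/-! ### Derivatives along a positive solution -/

namespace IsPositiveSolutionOn

variable {N : ℕ} {m p σ α β : ℝ} {f : ℝ → ℝ} {I : Set ℝ}

theorem pos (h : IsPositiveSolutionOn N m p σ α β f I) {x : ℝ} (hx : x ∈ I) : 0 < f x :=
  h.2.1 x hx

theorem mono (h : IsPositiveSolutionOn N m p σ α β f I) {J : Set ℝ} (hJ : J ⊆ I) :
    IsPositiveSolutionOn N m p σ α β f J :=
  ⟨h.1.mono hJ, fun x hx => h.2.1 x (hJ hx), fun x hx => h.2.2 x (hJ hx)⟩

theorem contDiffAt (h : IsPositiveSolutionOn N m p σ α β f I) (hI : IsOpen I) {x : ℝ}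
    (hx : x ∈ I) : ContDiffAt ℝ 2 f x :=
  h.1.contDiffAt (hI.mem_nhds hx)

theorem hasDerivAt (h : IsPositiveSolutionOn N m p σ α β f I) (hI : IsOpen I) {x : ℝ}
    (hx : x ∈ I) : HasDerivAt f (deriv f x) x :=
  ((h.contDiffAt hI hx).differentiableAt (by norm_num)).hasDerivAt

theorem contDiffAt_rpow (h : IsPositiveSolutionOn N m p σ α β f I) (hI : IsOpen I) {x : ℝ}
    (hx : x ∈ I) : ContDiffAt ℝ 2 (fun s => f s ^ m) x :=
  (h.contDiffAt hI hx).rpow_const_of_ne (h.pos hx).ne'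

theorem deriv_rpow (h : IsPositiveSolutionOn N m p σ α β f I) (hI : IsOpen I) {x : ℝ}
    (hx : x ∈ I) : deriv (fun s => f s ^ m) x = m * f x ^ (m - 1) * deriv f x := by
  rw [((h.hasDerivAt hI hx).rpow_const (Or.inl (h.pos hx).ne')).deriv]
  ring

theorem hasDerivAt_rpow (h : IsPositiveSolutionOn N m p σ α β f I) (hI : IsOpen I) {x : ℝ}
    (hx : x ∈ I) : HasDerivAt (fun s => f s ^ m) (deriv (fun s => f s ^ m) x) x :=
  ((h.contDiffAt_rpow hI hx).differentiableAt (by norm_num)).hasDerivAt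

theorem hasDerivAt_deriv_rpow (h : IsPositiveSolutionOn N m p σ α β f I) (hI : IsOpen I) {x : ℝ}
    (hx : x ∈ I) :
    HasDerivAt (deriv (fun s => f s ^ m)) (deriv (deriv (fun s => f s ^ m)) x) x :=
  have hc : ContDiffOn ℝ 2 (fun s => f s ^ m) I :=
    fun y hy => (h.contDiffAt_rpow hI hy).contDiffWithinAt
  have hc1 : ContDiffOn ℝ 1 (deriv fun s => f s ^ m) I :=
    hc.deriv_of_isOpen hI (by norm_num)
  ((hc1.contDiffAt (hI.mem_nhds hx)).differentiableAt (by norm_num)).hasDerivAt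

end IsPositiveSolutionOn

/-- The flux `(f^m)' + (N-1)/ξ f^m + β ξ f`, whose derivative contains no derivative of `f` when
`f` solves the profile equation. -/
noncomputable def profileFlux (N : ℕ) (m β : ℝ) (f : ℝ → ℝ) (s : ℝ) : ℝ :=
  deriv (fun s => f s ^ m) s + ((N : ℝ) - 1) / s * f s ^ m + β * s * f s

/-- The equation in integrated form: `β ξ f' = (β ξ f)' - β f` and `(N-1)/ξ w' = ((N-1) w/ξ)' +
(N-1) w/ξ²`, so every derivative is absorbed into the flux. -/
theorem IsPositiveSolutionOn.hasDerivAt_profileFlux {N : ℕ} {m p σ α β : ℝ} {f : ℝ → ℝ}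
    {I : Set ℝ} (h : IsPositiveSolutionOn N m p σ α β f I) (hI : IsOpen I) {x : ℝ} (hx : x ∈ I)
    (hx0 : 0 < x) :
    HasDerivAt (profileFlux N m β f)
      ((α + β) * f x - x ^ σ * f x ^ p - ((N : ℝ) - 1) / x ^ 2 * f x ^ m) x := by
  have h1 := (h.hasDerivAt_deriv_rpow hI hx).add
    (((hasDerivAt_const x ((N : ℝ) - 1)).div (hasDerivAt_id x) hx0.ne').mul
      (h.hasDerivAt_rpow hI hx))
  have h2 := h1.add (((hasDerivAt_id x).const_mul β).mul (h.hasDerivAt hI hx))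
  refine (h2.congr_deriv ?_)
  have ode := h.2.2 x hx
  simp only [id, Pi.div_apply]
  linear_combination ode

/-! ### No solution reaches zero with zero flux when `m + p < 2` -/

theorem Filter.Eventually.exists_Ioo_nhdsLT {P : ℝ → Prop} {b : ℝ} (h : ∀ᶠ x in 𝓝[<] b, P x)
    {a₀ : ℝ} (ha₀ : a₀ < b) : ∃ a, a₀ ≤ a ∧ a < b ∧ ∀ x ∈ Ioo a b, P x := by
  obtain ⟨l, hl, hs⟩ := mem_nhdsLT_iff_exists_Ioo_subset.1 h
  exact ⟨max a₀ l, le_max_left _ _, max_lt ha₀ hl,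
    fun x hx => hs ⟨(le_max_right _ _).trans_lt hx.1, hx.2⟩⟩

/-- Writing `f = f^(1-p) f^p` with `f^(1-p) → 0`: near extinction the reaction beats any linear
term. -/
theorem eventually_mul_le_rpow {f : ℝ → ℝ} {b p C κ : ℝ} (hp1 : p < 1) (hκ : 0 < κ)
    (hf : Tendsto f (𝓝[<] b) (𝓝 0)) (hpos : ∀ᶠ x in 𝓝[<] b, 0 < f x) :
    ∀ᶠ x in 𝓝[<] b, C * f x ≤ κ * f x ^ p := by
  have h1 : Tendsto (fun x => C * f x ^ (1 - p)) (𝓝[<] b) (𝓝 0) := by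
    have := (hf.rpow_const (p := 1 - p) (Or.inr (by linarith))).const_mul C
    rwa [Real.zero_rpow (by linarith), mul_zero] at this
  filter_upwards [h1.eventually_le_const hκ, hpos] with x hx hx0
  have h2 : f x = f x ^ (1 - p) * f x ^ p := by
    rw [← Real.rpow_add hx0]; simp
  calc C * f x = C * f x ^ (1 - p) * f x ^ p := by rw [mul_assoc, ← h2]
    _ ≤ κ * f x ^ p := mul_le_mul_of_nonneg_right hx (Real.rpow_nonneg hx0.le _)

/-- The zero-flux condition is only asked along points accumulating at `b`, so that it follows both
from a vanishing one-sided derivative at `b` and from `w' → 0`. -/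
theorem IsPositiveSolutionOn.false_of_tendsto_zero_of_frequently {N : ℕ} {m p σ α β : ℝ}
    {f : ℝ → ℝ} {b : ℝ} (hN : 1 ≤ N) (hm : 1 < m) (hp0 : 0 < p) (hp1 : p < 1) (hσ : 0 ≤ σ)
    (hmp : m + p < 2) (hb : 0 < b) (h : IsPositiveSolutionOn N m p σ α β f (Ioo 0 b))
    (hf : Tendsto f (𝓝[<] b) (𝓝 0))
    (hfr : ∀ ε > 0, ∃ᶠ x in 𝓝[<] b, -ε < deriv (fun s => f s ^ m) x) : False := by
  have hI : IsOpen (Ioo (0 : ℝ) b) := isOpen_Ioo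
  set w : ℝ → ℝ := fun s => f s ^ m with hw
  set κ : ℝ := (b / 2) ^ σ with hκdef
  have hκ : 0 < κ := Real.rpow_pos_of_pos (by linarith) _
  have hN' : (0 : ℝ) ≤ (N : ℝ) - 1 := by
    have : (1 : ℝ) ≤ N := by exact_mod_cast hN
    linarith
  have hposev : ∀ᶠ x in 𝓝[<] b, 0 < f x := by
    filter_upwards [Ioo_mem_nhdsLT hb] with x hx using h.pos hx
  -- Only half of `κ f^p` is spent on the linear terms; the other half keeps `G` strictly
  -- decreasing. The bound `f < 1` gives `f^m ≤ f`.
  obtain ⟨a, ha, hab, hprop⟩ := ((eventually_mul_le_rpow (C := |α| + |β|) hp1 (half_pos hκ) hf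
    hposev).and (hf.eventually_lt_const one_pos)).exists_Ioo_nhdsLT (half_lt_self hb)
  have ha0 : 0 < a := by linarith
  have hsub : Ioo a b ⊆ Ioo 0 b := Ioo_subset_Ioo_left ha0.le
  have hfpos : ∀ x ∈ Ioo a b, 0 < f x := fun x hx => h.pos (hsub hx)
  have hx0 : ∀ x ∈ Ioo a b, 0 < x := fun x hx => ha0.trans hx.1
  have hκle : ∀ x ∈ Ioo a b, κ ≤ x ^ σ := fun x hx =>
    Real.rpow_le_rpow (by linarith) (by linarith [hx.1]) hσ
  have hfp : ∀ x ∈ Ioo a b, 0 < f x ^ p := fun x hx => Real.rpow_pos_of_pos (hfpos x hx) p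
  have hwle : ∀ x ∈ Ioo a b, f x ^ m ≤ f x := fun x hx => by
    have := Real.rpow_le_rpow_of_exponent_ge (hfpos x hx) (hprop x hx).2.le hm.le
    rwa [Real.rpow_one] at this
  -- the flux is strictly decreasing
  set G := profileFlux N m β f with hG
  set G' : ℝ → ℝ := fun x =>
    (α + β) * f x - x ^ σ * f x ^ p - ((N : ℝ) - 1) / x ^ 2 * f x ^ m with hG'
  have hGd : ∀ x ∈ Ioo a b, HasDerivAt G (G' x) x :=
    fun x hx => h.hasDerivAt_profileFlux hI (hsub hx) (hx0 x hx)
  have hG'le : ∀ x ∈ Ioo a b, G' x ≤ -(κ / 2) * f x ^ p := by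
    intro x hx
    have h1 := (hprop x hx).1
    have h2 : (α + β) * f x ≤ (|α| + |β|) * f x :=
      mul_le_mul_of_nonneg_right (add_le_add (le_abs_self _) (le_abs_self _)) (hfpos x hx).le
    have h3 : κ * f x ^ p ≤ x ^ σ * f x ^ p :=
      mul_le_mul_of_nonneg_right (hκle x hx) (hfp x hx).le
    have h4 : 0 ≤ ((N : ℝ) - 1) / x ^ 2 * f x ^ m :=
      mul_nonneg (div_nonneg hN' (sq_nonneg x)) (Real.rpow_nonneg (hfpos x hx).le _)
    simp only [hG']
    linarith
  have hGanti : ∀ x ∈ Ioo a b, ∀ y ∈ Ioo a b, x < y → G y < G x := by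
    have : StrictAntiOn G (Ioo a b) := strictAntiOn_of_deriv_neg (convex_Ioo a b)
      (fun x hx => (hGd x hx).continuousAt.continuousWithinAt) (fun x hx => by
        rw [interior_Ioo] at hx
        rw [(hGd x hx).deriv]
        have := mul_pos (half_pos hκ) (hfp x hx)
        linarith [hG'le x hx])
    exact fun x hx y hy hxy => this hx hy hxy
  -- the difference between flux and `w'` tends to zero
  set C : ℝ := ((N : ℝ) - 1) / a + |β| * b + 1 with hC
  have hC0 : 0 < C := by positivity
  have hdiff : ∀ x ∈ Ioo a b, |G x - deriv w x| ≤ C * f x := by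
    intro x hx
    have e : G x - deriv w x = ((N : ℝ) - 1) / x * f x ^ m + β * x * f x := by
      simp only [hG, profileFlux, hw]; ring
    have h1 : |((N : ℝ) - 1) / x * f x ^ m| ≤ ((N : ℝ) - 1) / a * f x := by
      rw [abs_of_nonneg (mul_nonneg (div_nonneg hN' (hx0 x hx).le)
        (Real.rpow_nonneg (hfpos x hx).le _))]
      exact mul_le_mul (div_le_div_of_nonneg_left hN' ha0 hx.1.le) (hwle x hx)
        (Real.rpow_nonneg (hfpos x hx).le _) (div_nonneg hN' ha0.le)
    have h2 : |β * x * f x| ≤ |β| * b * f x := by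
      rw [abs_mul, abs_mul, abs_of_pos (hfpos x hx), abs_of_pos (hx0 x hx)]
      exact mul_le_mul_of_nonneg_right (mul_le_mul_of_nonneg_left hx.2.le (abs_nonneg _))
        (hfpos x hx).le
    rw [e]
    have := (abs_add_le _ _).trans (add_le_add h1 h2)
    simp only [hC]
    linarith [hfpos x hx]
  -- A negative value of `G` persists to the right. As `G - w' → 0`, it would keep `w'` below a
  -- negative constant up to `b`.
  have hGnonneg : ∀ x ∈ Ioo a b, 0 ≤ G x := by
    intro x hx
    by_contra! hneg
    have hsmall : ∀ᶠ y in 𝓝[<] b, C * f y < -G x / 2 := by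
      have := hf.const_mul C
      rw [mul_zero] at this
      exact this.eventually_lt_const (by linarith)
    have hev : ∀ᶠ y in 𝓝[<] b, deriv w y ≤ -(-G x / 2) := by
      filter_upwards [hsmall, Ioo_mem_nhdsLT hx.2] with y hy hxy
      have hy' : y ∈ Ioo a b := ⟨hx.1.trans hxy.1, hxy.2⟩
      have h1 := (abs_le.1 (hdiff y hy')).1
      have h2 := hGanti x hx y hy' hxy.1
      linarith
    exact ((hfr (-G x / 2) (by linarith)).and_eventually hev).exists.elim
      fun y hy => absurd hy.2 (not_le.2 hy.1)
  have hGpos : ∀ x ∈ Ioo a b, 0 < G x := by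
    intro x hx
    have hy : (x + b) / 2 ∈ Ioo a b := ⟨by linarith [hx.1, hx.2], by linarith [hx.2]⟩
    exact (hGnonneg _ hy).trans_lt (hGanti x hx _ hy (by linarith [hx.2]))
  -- `w` is eventually nonincreasing
  have hwd : ∀ x ∈ Ioo a b, HasDerivAt w (deriv w x) x :=
    fun x hx => h.hasDerivAt_rpow hI (hsub hx)
  have hwlim : Tendsto w (𝓝[<] b) (𝓝 0) := by
    have := hf.rpow_const (p := m) (Or.inr (by linarith))
    rwa [Real.zero_rpow (by linarith)] at this
  obtain ⟨c, hc, hcneg⟩ : ∃ c ∈ Ioo a b, deriv w c ≤ 0 := by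
    by_contra! hcon
    have hx : (a + b) / 2 ∈ Ioo a b := ⟨by linarith, by linarith⟩
    have : w ((a + b) / 2) ≤ 0 := by
      refine ge_of_tendsto hwlim ?_
      filter_upwards [Ioo_mem_nhdsLT hx.2] with y hy
      have hy' : y ∈ Ioo a b := ⟨hx.1.trans hy.1, hy.2⟩
      have := mul_sub_le_sub_of_le_hasDerivAt (convex_Ioo a b) hwd
        (fun z hz => (hcon z hz).le) hx hy' hy.1.le
      linarith
    exact absurd this (not_le.2 (Real.rpow_pos_of_pos (hfpos _ hx) m))
  have hw'le : ∀ x ∈ Ioo c b, deriv w x ≤ 0 := by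
    intro x hx
    -- At a zero of `w'` also `f' = 0`, so `w'' = α f - ξ^σ f^p < 0`: `w'` crosses zero only
    -- downwards.
    have hsub' : Icc c x ⊆ Ioo a b := fun z hz => ⟨hc.1.trans_le hz.1, hz.2.trans_lt hx.2⟩
    refine nonpos_of_hasDerivAt_neg_of_eq_zero hcneg
      (fun z hz => h.hasDerivAt_deriv_rpow hI (hsub (hsub' hz))) (fun z hz hz0 => ?_) x
      ⟨hx.1.le, le_rfl⟩
    have hz' := hsub' hz
    have ode := h.2.2 z (hsub hz')
    have hd := h.deriv_rpow hI (hsub hz')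
    have hf0 : deriv f z = 0 := by
      have h0 : m * f z ^ (m - 1) * deriv f z = 0 := by rw [← hd]; exact hz0
      have : m * f z ^ (m - 1) ≠ 0 :=
        (mul_pos (by linarith) (Real.rpow_pos_of_pos (hfpos z hz') _)).ne'
      exact (mul_eq_zero.1 h0).resolve_left this
    have hz0' : deriv (fun s => f s ^ m) z = 0 := hz0
    rw [hf0, hz0'] at ode
    have h1 := (hprop z hz').1
    have h2 : α * f z ≤ (|α| + |β|) * f z := mul_le_mul_of_nonneg_right
      ((le_abs_self _).trans (le_add_of_nonneg_right (abs_nonneg _))) (hfpos z hz').le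
    have h3 : κ * f z ^ p ≤ z ^ σ * f z ^ p :=
      mul_le_mul_of_nonneg_right (hκle z hz') (hfp z hz').le
    have h4 := mul_pos hκ (hfp z hz')
    have : deriv (deriv fun s => f s ^ m) z < 0 := by linarith
    exact this
  have hsub2 : Ioo c b ⊆ Ioo a b := Ioo_subset_Ioo_left hc.1.le
  have hGle : ∀ x ∈ Ioo c b, G x ≤ C * f x := fun x hx => by
    linarith [(abs_le.1 (hdiff x (hsub2 hx))).2, hw'le x hx]
  -- lower bound for the flux
  have hlow : ∀ x ∈ Ioo c b, (1 - p) * (κ / 2 / C ^ p) * (b - x) ≤ G x ^ (1 - p) := by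
    intro x hx
    have hlim : Tendsto (fun y => (1 - p) * (κ / 2 / C ^ p) * (y - x)) (𝓝[<] b)
        (𝓝 ((1 - p) * (κ / 2 / C ^ p) * (b - x))) :=
      ((continuous_const.mul (continuous_id.sub continuous_const)).tendsto b).mono_left
        nhdsWithin_le_nhds
    refine le_of_tendsto hlim ?_
    filter_upwards [Ioo_mem_nhdsLT hx.2] with y hy
    refine mul_sub_le_rpow_of_hasDerivAt_le (convex_Ioo c b) hp1
      (fun z hz => hGpos z (hsub2 hz)) (fun z hz => hGd z (hsub2 hz)) (fun z hz => ?_) hx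
      ⟨hx.1.trans hy.1, hy.2⟩ hy.1.le
    -- The bound `G ≤ C f` turns `G' ≤ -(κ/2) f^p` into the closed inequality `G' ≤ -(κ/2/C^p) G^p`.
    have h1 : G z ^ p ≤ C ^ p * f z ^ p := by
      rw [← Real.mul_rpow hC0.le (hfpos z (hsub2 hz)).le]
      exact Real.rpow_le_rpow (hGpos z (hsub2 hz)).le (hGle z hz) hp0.le
    have hCp : 0 < C ^ p := Real.rpow_pos_of_pos hC0 p
    have h2 : κ / 2 / C ^ p * G z ^ p ≤ κ / 2 * f z ^ p := by
      calc κ / 2 / C ^ p * G z ^ p ≤ κ / 2 / C ^ p * (C ^ p * f z ^ p) :=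
            mul_le_mul_of_nonneg_left h1 (by positivity)
        _ = κ / 2 * f z ^ p := by field_simp
    linarith [hG'le z (hsub2 hz)]
  -- upper bound for `f^(m-1)`
  have hup : ∀ x ∈ Ioo a b, f x ^ (m - 1) ≤ (m - 1) * C / m * (b - x) := by
    intro x hx
    have hlim : Tendsto (fun y => f y ^ (m - 1) + (m - 1) * C / m * (y - x)) (𝓝[<] b)
        (𝓝 (0 + (m - 1) * C / m * (b - x))) := by
      refine Tendsto.add ?_ (((continuous_const.mul
        (continuous_id.sub continuous_const)).tendsto b).mono_left nhdsWithin_le_nhds)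
      have := hf.rpow_const (p := m - 1) (Or.inr (by linarith))
      rwa [Real.zero_rpow (by linarith)] at this
    rw [zero_add] at hlim
    refine ge_of_tendsto hlim ?_
    filter_upwards [Ioo_mem_nhdsLT hx.2] with y hy
    have := mul_sub_le_sub_of_le_hasDerivAt (h := fun x => f x ^ (m - 1)) (C := -((m - 1) * C / m))
      (convex_Ioo a b)
      (fun z hz => (h.hasDerivAt hI (hsub hz)).rpow_const (Or.inl (hfpos z hz).ne'))
      (fun z hz => ?_) hx ⟨hx.1.trans hy.1, hy.2⟩ hy.1.le
    · linarith
    · have hd := h.deriv_rpow hI (hsub hz)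
      -- Positivity of `G` gives `w' ≥ -C f`; dividing by `f` bounds `(f^(m-1))'` from below.
      have h1 : -(C * f z) ≤ m * f z ^ (m - 1) * deriv f z := by
        rw [← hd]
        have e1 := (abs_le.1 (hdiff z hz)).2
        have e2 := hGpos z hz
        simp only [hw] at e1
        linarith
      have h2 : f z ^ (m - 1) = f z * f z ^ (m - 1 - 1) := by
        rw [← Real.rpow_one_add' (hfpos z hz).le (by linarith)]; congr 1; ring
      have h3 : -C ≤ m * f z ^ (m - 1 - 1) * deriv f z := by
        rw [h2] at h1
        have : -C * f z ≤ (m * f z ^ (m - 1 - 1) * deriv f z) * f z := by linarith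
        exact le_of_mul_le_mul_right this (hfpos z hz)
      have hm0 : 0 < m := by linarith
      calc -((m - 1) * C / m) = (m - 1) / m * (-C) := by ring
        _ ≤ (m - 1) / m * (m * f z ^ (m - 1 - 1) * deriv f z) :=
          mul_le_mul_of_nonneg_left h3 (div_nonneg (by linarith) hm0.le)
        _ = deriv f z * (m - 1) * f z ^ (m - 1 - 1) := by field_simp
  -- comparison
  set A : ℝ := (1 - p) * (κ / 2 / C ^ p) with hA
  have hA0 : 0 < A := mul_pos (by linarith) (div_pos (half_pos hκ) (Real.rpow_pos_of_pos hC0 p))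
  set B : ℝ := C ^ (1 - p) * ((m - 1) * C / m) with hB
  have hev : ∀ᶠ x in 𝓝[<] b, B * f x ^ (2 - m - p) < A := by
    have := (hf.rpow_const (p := 2 - m - p) (Or.inr (by linarith))).const_mul B
    rw [Real.zero_rpow (by linarith), mul_zero] at this
    exact this.eventually_lt_const hA0
  obtain ⟨x, hx1, hx⟩ := (hev.and (Ioo_mem_nhdsLT hc.2)).exists
  have hfx := hfpos x (hsub2 hx)
  have hbx : 0 < b - x := sub_pos.2 hx.2
  have hCp : 0 < C ^ (1 - p) := Real.rpow_pos_of_pos hC0 _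
  have h1 : A * (b - x) ≤ B * f x ^ (2 - m - p) * (b - x) := by
    calc A * (b - x) ≤ G x ^ (1 - p) := hlow x hx
      _ ≤ (C * f x) ^ (1 - p) :=
        Real.rpow_le_rpow (hGpos x (hsub2 hx)).le (hGle x hx) (by linarith)
      _ = C ^ (1 - p) * (f x ^ (m - 1) * f x ^ (2 - m - p)) := by
        rw [Real.mul_rpow hC0.le hfx.le, ← Real.rpow_add hfx]; congr 2; ring
      _ ≤ C ^ (1 - p) * (((m - 1) * C / m * (b - x)) * f x ^ (2 - m - p)) :=
        mul_le_mul_of_nonneg_left (mul_le_mul_of_nonneg_right (hup x (hsub2 hx))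
          (Real.rpow_nonneg hfx.le _)) hCp.le
      _ = B * f x ^ (2 - m - p) * (b - x) := by rw [hB]; ring
  exact absurd (le_of_mul_le_mul_right h1 hbx) (not_le.2 hx1)

theorem not_isGoodProfile {N : ℕ} {m p σ : ℝ} (hN : 1 ≤ N) (hm : 1 < m) (hp0 : 0 < p)
    (hp1 : p < 1) (hσ : 0 ≤ σ) (hmp : m + p < 2) (α β : ℝ) (f : ℝ → ℝ) :
    ¬ IsGoodProfile N m p σ α β f := by
  rintro ⟨-, b, hb, h, -, hfb, hder⟩
  have hI : IsOpen (Ioo (0 : ℝ) b) := isOpen_Ioo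
  have hm0 : 0 < m := by linarith
  have hwlim : Tendsto (fun s => f s ^ m) (𝓝[<] b) (𝓝 0) := by
    have := hder.continuousWithinAt.tendsto.mono_left (nhdsWithin_mono b Iio_subset_Iic_self)
    simpa [hfb, Real.zero_rpow hm0.ne'] using this
  have hf : Tendsto f (𝓝[<] b) (𝓝 0) := by
    have h1 := hwlim.rpow_const (p := m⁻¹) (Or.inr (by positivity))
    rw [Real.zero_rpow (by positivity)] at h1
    refine h1.congr' ?_
    filter_upwards [Ioo_mem_nhdsLT hb] with x hx
    exact Real.rpow_rpow_inv (h.pos hx).le hm0.ne'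
  refine h.false_of_tendsto_zero_of_frequently hN hm hp0 hp1 hσ hmp hb hf fun ε hε => ?_
  have hslope : ∀ᶠ x in 𝓝[<] b, -ε < slope (fun s => f s ^ m) b x := by
    have := (hasDerivWithinAt_iff_tendsto_slope.1 hder)
    rw [Iic_sdiff_right] at this
    exact this.eventually_const_lt (by linarith)
  rw [frequently_iff]
  intro U hU
  obtain ⟨a, ha, hab, hs⟩ := (Filter.Eventually.and hslope hU).exists_Ioo_nhdsLT hb
  have hx : (a + b) / 2 ∈ Ioo a b := ⟨by linarith, by linarith⟩
  have hcont : ContinuousOn (fun s => f s ^ m) (Icc ((a + b) / 2) b) := by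
    intro z hz
    rcases hz.2.eq_or_lt with rfl | hzb
    · exact hder.continuousWithinAt.mono Icc_subset_Iic_self
    · exact (h.hasDerivAt_rpow hI
        ⟨(ha.trans_lt hx.1).trans_le hz.1, hzb⟩).continuousAt.continuousWithinAt
  -- Only the derivative at `b` is known; the mean value theorem turns small chord slopes into
  -- interior points where `w' > -ε`.
  obtain ⟨c, hc, hceq⟩ := exists_hasDerivAt_eq_slope (fun s => f s ^ m)
    (deriv fun s => f s ^ m) hx.2 hcont
    (fun z hz => h.hasDerivAt_rpow hI ⟨(ha.trans_lt hx.1).trans hz.1, hz.2⟩)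
  refine ⟨c, (hs c ⟨hx.1.trans hc.1, hc.2⟩).2, ?_⟩
  have := (hs _ hx).1
  rw [slope_comm, slope_def_field, ← hceq] at this
  exact this

/-! ### Radial functions and self-similar solutions -/

section Radial

variable {E : Type*} [NormedAddCommGroup E] [InnerProductSpace ℝ E]

theorem hasFDerivAt_norm_of_ne_zero {x : E} (hx : x ≠ 0) :
    HasFDerivAt (fun y : E => ‖y‖) (‖x‖⁻¹ • innerSL ℝ x) x := by
  have h := (hasStrictFDerivAt_norm_sq x).hasFDerivAt.sqrt (pow_ne_zero 2 (norm_ne_zero_iff.2 hx))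
  simp only [Real.sqrt_sq (norm_nonneg _)] at h
  refine h.congr_fderiv ?_
  have := norm_ne_zero_iff.2 hx
  ext v
  simp
  field_simp

theorem HasDerivAt.hasFDerivAt_comp_norm {g : ℝ → ℝ} {g' : ℝ} {x : E} (hx : x ≠ 0)
    (hg : HasDerivAt g g' ‖x‖) :
    HasFDerivAt (fun y : E => g ‖y‖) ((g' / ‖x‖) • innerSL ℝ x) x := by
  have h := hg.comp_hasFDerivAt x (hasFDerivAt_norm_of_ne_zero hx)
  rw [smul_smul] at h
  exact h

/-- The Laplacian of a radial function. -/
theorem laplacian_comp_norm [FiniteDimensional ℝ E] {g : ℝ → ℝ} {x : E} (hx : x ≠ 0)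
    (hg : ContDiffAt ℝ 2 g ‖x‖) :
    Laplacian.laplacian (fun y : E => g ‖y‖) x =
      deriv (deriv g) ‖x‖ + ((Module.finrank ℝ E : ℝ) - 1) / ‖x‖ * deriv g ‖x‖ := by
  have hr : 0 < ‖x‖ := norm_pos_iff.2 hx
  have hd1 : ∀ᶠ s in 𝓝 ‖x‖, HasDerivAt g (deriv g s) s := by
    filter_upwards [hg.eventually (by simp)] with s hs
    exact (hs.differentiableAt (by norm_num)).hasDerivAt
  have hd2 : HasDerivAt (deriv g) (deriv (deriv g) ‖x‖) ‖x‖ := by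
    obtain ⟨u, hu, hgu⟩ := hg.contDiffOn (m := 2) le_rfl (by simp)
    have hc : ContDiffOn ℝ 1 (deriv g) (interior u) :=
      (hgu.mono interior_subset).deriv_of_isOpen isOpen_interior
        (by norm_num)
    have hx' := isOpen_interior.mem_nhds (mem_interior_iff_mem_nhds.2 hu)
    exact ((hc.contDiffAt hx').differentiableAt (by norm_num)).hasDerivAt
  have hfd : fderiv ℝ (fun y : E => g ‖y‖) =ᶠ[𝓝 x]
      fun y => (deriv g ‖y‖ / ‖y‖) • innerSL ℝ y := by
    filter_upwards [continuous_norm.continuousAt.eventually hd1, isOpen_ne.mem_nhds hx]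
      with y hy hy0
    exact (HasDerivAt.hasFDerivAt_comp_norm hy0 hy).fderiv
  have hq : HasDerivAt (fun s => deriv g s / s)
      ((deriv (deriv g) ‖x‖ * ‖x‖ - deriv g ‖x‖ * 1) / ‖x‖ ^ 2) ‖x‖ :=
    hd2.div (hasDerivAt_id _) hr.ne'
  -- With `q(s) = g'(s)/s` the gradient is `q(‖y‖) y`, and the Hessian at `x` is `q Id + (q'/‖x‖) x
  -- ⊗ x`. Its trace uses Parseval for `∑ ⟨x, eᵢ⟩²`.
  have hfd2 : HasFDerivAt (fun y => (deriv g ‖y‖ / ‖y‖) • innerSL ℝ y) _ x :=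
    (HasDerivAt.hasFDerivAt_comp_norm hx hq).smul
    (innerSL ℝ (E := E)).hasFDerivAt
  rw [InnerProductSpace.laplacian_eq_iteratedFDeriv_stdOrthonormalBasis]
  simp only [iteratedFDeriv_two_apply]
  rw [hfd.fderiv_eq, hfd2.fderiv]
  have hsum := (stdOrthonormalBasis ℝ E).sum_sq_inner_left x
  have hb : ∀ i, inner ℝ (stdOrthonormalBasis ℝ E i) (stdOrthonormalBasis ℝ E i) = (1 : ℝ) := by
    intro i; simp
  set q' : ℝ := (deriv (deriv g) ‖x‖ * ‖x‖ - deriv g ‖x‖ * 1) / ‖x‖ ^ 2 with hq'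
  have hterm : ∀ i, deriv g ‖x‖ / ‖x‖ *
        inner ℝ (stdOrthonormalBasis ℝ E i) (stdOrthonormalBasis ℝ E i) +
      q' / ‖x‖ * inner ℝ x (stdOrthonormalBasis ℝ E i) * inner ℝ x (stdOrthonormalBasis ℝ E i) =
      deriv g ‖x‖ / ‖x‖ + q' / ‖x‖ * inner ℝ x (stdOrthonormalBasis ℝ E i) ^ 2 := by
    intro i
    rw [hb]
    ring
  refine (Finset.sum_congr rfl fun i _ => hterm i).trans ?_
  rw [Finset.sum_add_distrib, ← Finset.mul_sum, hsum, Finset.sum_const, Finset.card_univ,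
    Fintype.card_fin, nsmul_eq_mul, hq']
  field_simp
  ring

end Radial

/-- At `t = 0` the solution is `f(‖x‖)` and its time derivative is `α f - β r f'`, so that single
time slice already yields the profile equation. -/
theorem not_isEternalSolutionWithInterface {N : ℕ} {m p σ : ℝ} (hN : 1 ≤ N) (hm : 1 < m)
    (hp0 : 0 < p) (hp1 : p < 1) (hσ : 0 ≤ σ) (hmp : m + p < 2)
    (u : EuclideanSpace ℝ (Fin N) → ℝ → ℝ) : ¬ IsEternalSolutionWithInterface N m p σ u := by
  rintro ⟨α, β, f, hu, -, -, hflat, ⟨b, hb, hint⟩, hC2, hpde⟩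
  refine not_isGoodProfile hN hm hp0 hp1 hσ hmp α β f ⟨hflat, b, hb, ?_, hint⟩
  have hC : ContDiffOn ℝ 2 f (Ioo 0 b) := hC2.mono fun x hx => ⟨hx.1, hint.1 x hx⟩
  refine ⟨hC, hint.1, fun r hr => ?_⟩
  have hfr := hint.1 r hr
  have hcd : ContDiffAt ℝ 2 f r := hC.contDiffAt (isOpen_Ioo.mem_nhds hr)
  set x : EuclideanSpace ℝ (Fin N) := r • EuclideanSpace.single (⟨0, hN⟩ : Fin N) (1 : ℝ) with hx
  have hnx : ‖x‖ = r := by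
    rw [hx, norm_smul, Real.norm_of_nonneg hr.1.le]; simp
  have hx0 : x ≠ 0 := by
    rw [← norm_pos_iff, hnx]; exact hr.1
  have hux : ∀ y, u y 0 = f ‖y‖ := fun y => by rw [hu]; simp
  have eqn := hpde x 0 hx0 (by rw [hux, hnx]; exact hfr)
  have hlap := laplacian_comp_norm (g := fun s => f s ^ m) hx0
    (by rw [hnx]; exact hcd.rpow_const_of_ne hfr.ne')
  simp only [hux] at eqn
  rw [hlap, hnx] at eqn
  have hfd : HasDerivAt f (deriv f r) (r * Real.exp (-β * 0)) := by
    have := (hcd.differentiableAt (by norm_num)).hasDerivAt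
    simpa using this
  have e1 : HasDerivAt (fun s : ℝ => r * Real.exp (-β * s)) (r * (-β)) 0 := by
    have := (((hasDerivAt_id (0 : ℝ)).const_mul (-β)).exp).const_mul r
    simpa using this
  have e2 : HasDerivAt (fun s : ℝ => Real.exp (α * s)) α 0 := by
    have := ((hasDerivAt_id (0 : ℝ)).const_mul α).exp
    simpa using this
  have e3 := e2.mul (hfd.comp (0 : ℝ) e1)
  have e4 : deriv (fun s => u x s) 0 = α * f r + deriv f r * (r * -β) := by
    have : (fun s => u x s) = fun s => Real.exp (α * s) * f (r * Real.exp (-β * s)) := by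
      funext s; rw [hu, hnx]
    rw [this]
    have := e3.deriv
    simpa [Function.comp_def, Pi.mul_def] using this
  rw [e4] at eqn
  simp only [finrank_euclideanSpace, Fintype.card_fin] at eqn
  linear_combination -eqn

/-! ### Scale-invariant variables -/

/-- The scale-invariant variable `ψ(ξ) = ξ^(-k-2) f(ξ)^m`. -/
noncomputable def scaledPower (k m : ℝ) (f : ℝ → ℝ) (s : ℝ) : ℝ := s ^ (-k) * (f s ^ m / s ^ 2)

/-- The scale-invariant flux `ξ ψ' + (2k + 2 + N) ψ + β φ`, where `φ = ξ^(-k) f`. -/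
noncomputable def scaledFlux (N : ℕ) (k m β : ℝ) (f : ℝ → ℝ) (s : ℝ) : ℝ :=
  s ^ (-k) * (deriv (fun s => f s ^ m) s / s + (k + N) * (f s ^ m / s ^ 2) + β * f s)

theorem rpow_neg_sub_one_mul_self {x : ℝ} (hx : 0 < x) (k : ℝ) : x ^ (-k - 1) * x = x ^ (-k) := by
  rw [← Real.rpow_add_one hx.ne']; congr 1; ring

theorem scaledPower_eq_rpow {k m x : ℝ} {f : ℝ → ℝ} (hk : k * m = k + 2) (hx : 0 < x)
    (hf : 0 < f x) : scaledPower k m f x = (x ^ (-k) * f x) ^ m := by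
  have h1 : x ^ (-k) = (x ^ (-k)) ^ m * x ^ 2 := by
    rw [← Real.rpow_mul hx.le, ← Real.rpow_natCast x 2, ← Real.rpow_add hx]
    congr 1
    push_cast
    linarith
  rw [Real.mul_rpow (Real.rpow_nonneg hx.le _) hf.le]
  have hx2 : x ^ 2 ≠ 0 := by positivity
  calc scaledPower k m f x = x ^ (-k) * (f x ^ m / x ^ 2) := rfl
    _ = ((x ^ (-k)) ^ m * x ^ 2) * (f x ^ m / x ^ 2) := by rw [← h1]
    _ = (x ^ (-k)) ^ m * f x ^ m := by rw [mul_assoc, mul_div_cancel₀ _ hx2]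

namespace IsPositiveSolutionOn

variable {N : ℕ} {m p σ α β k : ℝ} {f : ℝ → ℝ} {I : Set ℝ}

theorem scaledPower_pos (h : IsPositiveSolutionOn N m p σ α β f I) {x : ℝ} (hx : x ∈ I)
    (hx0 : 0 < x) : 0 < scaledPower k m f x :=
  mul_pos (Real.rpow_pos_of_pos hx0 _)
    (div_pos (Real.rpow_pos_of_pos (h.pos hx) _) (pow_pos hx0 2))

theorem hasDerivAt_scaledPower (h : IsPositiveSolutionOn N m p σ α β f I) (hI : IsOpen I) {x : ℝ}
    (hx : x ∈ I) (hx0 : 0 < x) :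
    HasDerivAt (scaledPower k m f) (x ^ (-k - 1) *
      ((x * deriv (fun s => f s ^ m) x - (k + 2) * f x ^ m) / x ^ 2)) x := by
  have h1 := (Real.hasDerivAt_rpow_const (p := -k) (Or.inl hx0.ne')).mul
    ((h.hasDerivAt_rpow hI hx).div (hasDerivAt_pow 2 x) (pow_ne_zero 2 hx0.ne'))
  refine h1.congr_deriv ?_
  simp only [Pi.div_apply]
  rw [← rpow_neg_sub_one_mul_self hx0 k]
  field_simp
  ring

/-- Because `α = k β`, the terms `-α f + β ξ f'` combine to `β ξ^k (ξ φ')`, which goes into the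
flux. What remains contains no derivative of `f`. -/
theorem hasDerivAt_scaledFlux (h : IsPositiveSolutionOn N m p σ α β f I) (hI : IsOpen I)
    (hα : α = k * β) {x : ℝ} (hx : x ∈ I) (hx0 : 0 < x) :
    HasDerivAt (scaledFlux N k m β f) (x ^ (-k - 1) *
      (-(x ^ σ * f x ^ p) - (k + 2) * (k + N) * (f x ^ m / x ^ 2))) x := by
  have hw := h.hasDerivAt_rpow hI hx
  have h1 := (Real.hasDerivAt_rpow_const (p := -k) (Or.inl hx0.ne')).mul
    ((((h.hasDerivAt_deriv_rpow hI hx).div (hasDerivAt_id x) hx0.ne').add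
      ((hw.div (hasDerivAt_pow 2 x) (pow_ne_zero 2 hx0.ne')).const_mul (k + N))).add
        ((h.hasDerivAt hI hx).const_mul β))
  refine h1.congr_deriv ?_
  have ode := h.2.2 x hx
  simp only [Pi.div_apply, Pi.add_apply, id]
  rw [← rpow_neg_sub_one_mul_self hx0 k]
  subst hα
  have e : deriv (deriv fun s => f s ^ m) x = -(((N : ℝ) - 1) / x * deriv (fun s => f s ^ m) x)
      + k * β * f x - β * x * deriv f x - x ^ σ * f x ^ p := by linarith
  rw [e]
  field_simp
  ring

/-- `ξ (f^m)' ≤ (k+2) f^m` propagates to the right. -/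
theorem mul_deriv_le_of_Icc_subset (h : IsPositiveSolutionOn N m p σ α β f I) (hI : IsOpen I)
    (hN : 1 ≤ N) (hm : 1 < m) (hk0 : 0 < k) (hk : k * m = k + 2) (hα : α = k * β) {c x : ℝ}
    (hc0 : 0 < c) (hcx : c ≤ x) (hsub : Icc c x ⊆ I)
    (hc : c * deriv (fun s => f s ^ m) c ≤ (k + 2) * f c ^ m) :
    x * deriv (fun s => f s ^ m) x ≤ (k + 2) * f x ^ m := by
  have hN' : (1 : ℝ) ≤ N := by exact_mod_cast hN
  have key := nonpos_of_hasDerivAt_neg_of_eq_zero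
    (h := fun s => s * deriv (fun s => f s ^ m) s - (k + 2) * f s ^ m) (a := c) (b := x)
    (by linarith)
    (fun z hz => ((hasDerivAt_id z).mul (h.hasDerivAt_deriv_rpow hI (hsub hz))).sub
      ((h.hasDerivAt_rpow hI (hsub hz)).const_mul (k + 2)))
    (fun z hz hz0 => ?_) x ⟨hcx, le_rfl⟩
  · linarith
  · have hzI := hsub hz
    have hz1 : 0 < z := hc0.trans_le hz.1
    have hfz := h.pos hzI
    have ode := h.2.2 z hzI
    have hd := h.deriv_rpow hI hzI
    have hwz : f z ^ m = f z * f z ^ (m - 1) := by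
      rw [← Real.rpow_one_add' hfz.le (by linarith)]; congr 1; ring
    have hwpos : 0 < f z ^ (m - 1) := Real.rpow_pos_of_pos hfz _
    -- At equality `ξ w' = (k+2) w` one has `ξ f' = k f`, so the terms with `α` and `β` cancel and
    -- the sign of `β` plays no role.
    have hf' : z * deriv f z = k * f z := by
      have : (m * f z ^ (m - 1)) * (z * deriv f z - k * f z) = 0 := by
        rw [hd, hwz] at hz0
        linear_combination hz0 - f z * f z ^ (m - 1) * hk
      have := (mul_eq_zero.1 this).resolve_left (by positivity)
      linarith
    have hfp : 0 < z ^ σ * f z ^ p :=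
      mul_pos (Real.rpow_pos_of_pos hz1 _) (Real.rpow_pos_of_pos hfz _)
    have hfm : 0 < f z ^ m := Real.rpow_pos_of_pos hfz _
    have hz2 : z * deriv (fun s => f s ^ m) z = (k + 2) * f z ^ m := by linarith
    subst hα
    have e : z * (deriv (deriv fun s => f s ^ m) z) =
        -((N : ℝ) - 1) * deriv (fun s => f s ^ m) z - z * (z ^ σ * f z ^ p) := by
      have h1 : z * (((N : ℝ) - 1) / z * deriv (fun s => f s ^ m) z) =
          ((N : ℝ) - 1) * deriv (fun s => f s ^ m) z := by field_simp
      linear_combination z * ode - h1 - z * β * hf'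
    have hw' : 0 < deriv (fun s => f s ^ m) z := by
      have : 0 < z * deriv (fun s => f s ^ m) z := by rw [hz2]; positivity
      exact pos_of_mul_pos_right this hz1.le
    have h3 : 0 ≤ ((N : ℝ) - 1) * deriv (fun s => f s ^ m) z :=
      mul_nonneg (by linarith) hw'.le
    have h4 : 0 < k * deriv (fun s => f s ^ m) z := mul_pos hk0 hw'
    have h5 := mul_pos hz1 hfp
    simp only [id, one_mul]
    linarith

/-- Near the origin `ξ^(-k-2) f^m` must decrease somewhere. -/
theorem exists_mul_deriv_le {b : ℝ} (hb : 0 < b)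
    (h : IsPositiveSolutionOn N m p σ α β f (Ioo 0 b)) (hk0 : 0 < k) (hf0 : 0 < f 0)
    (hcont : ContinuousWithinAt f (Ici 0) 0) :
    ∃ c ∈ Ioo 0 b, c * deriv (fun s => f s ^ m) c ≤ (k + 2) * f c ^ m := by
  have hlim : Tendsto (scaledPower k m f) (𝓝[>] 0) atTop := by
    have h1 : Tendsto (fun s => f s ^ m) (𝓝[>] 0) (𝓝 (f 0 ^ m)) :=
      (hcont.tendsto.mono_left (nhdsWithin_mono 0 Ioi_subset_Ici_self)).rpow_const
        (Or.inl hf0.ne')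
    have h2 : Tendsto (fun s : ℝ => s ^ (-k)) (𝓝[>] 0) atTop :=
      tendsto_rpow_neg_nhdsGT_zero (by linarith)
    have h3 : Tendsto (fun s : ℝ => (s ^ 2)⁻¹) (𝓝[>] 0) atTop := by
      refine tendsto_inv_nhdsGT_zero.comp ?_
      refine tendsto_nhdsWithin_iff.2 ⟨?_, ?_⟩
      · have := ((continuous_pow 2).tendsto (0 : ℝ)).mono_left
          (nhdsWithin_le_nhds (s := Ioi (0 : ℝ)))
        simpa using this
      · filter_upwards [self_mem_nhdsWithin] with s hs
        exact pow_pos (mem_Ioi.1 hs) 2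
    exact h2.atTop_mul_atTop₀ (h1.pos_mul_atTop (Real.rpow_pos_of_pos hf0 m) h3)
  have hx1 : b / 2 ∈ Ioo 0 b := ⟨by linarith, by linarith⟩
  obtain ⟨x, hx, hxm⟩ := ((hlim.eventually_gt_atTop (scaledPower k m f (b / 2))).and
    (Ioo_mem_nhdsGT hx1.1)).exists
  have hsub : Icc x (b / 2) ⊆ Ioo 0 b :=
    fun z hz => ⟨hxm.1.trans_le hz.1, hz.2.trans_lt hx1.2⟩
  obtain ⟨c, hc, hceq⟩ := exists_hasDerivAt_eq_slope (scaledPower k m f) _ hxm.2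
    (fun z hz => (h.hasDerivAt_scaledPower (k := k) isOpen_Ioo (hsub hz)
      (hsub hz).1).continuousAt.continuousWithinAt)
    (fun z hz => h.hasDerivAt_scaledPower (k := k) isOpen_Ioo (hsub (Ioo_subset_Icc_self hz))
      (hsub (Ioo_subset_Icc_self hz)).1)
  have hc' := hsub (Ioo_subset_Icc_self hc)
  refine ⟨c, hc', ?_⟩
  by_contra! hcon
  have h1 : 0 < c ^ (-k - 1) *
      ((c * deriv (fun s => f s ^ m) c - (k + 2) * f c ^ m) / c ^ 2) :=
    mul_pos (Real.rpow_pos_of_pos hc'.1 _) (div_pos (by linarith) (pow_pos hc'.1 2))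
  rw [hceq] at h1
  have h2 : (scaledPower k m f (b / 2) - scaledPower k m f x) / (b / 2 - x) < 0 :=
    div_neg_of_neg_of_pos (by linarith) (by linarith [hxm.2])
  linarith

theorem antitoneOn_scaledPower (h : IsPositiveSolutionOn N m p σ α β f I) (hI : IsOpen I)
    {D : Set ℝ} (hD : Convex ℝ D) (hDI : D ⊆ I) (hD0 : ∀ x ∈ D, 0 < x)
    (hle : ∀ x ∈ D, x * deriv (fun s => f s ^ m) x ≤ (k + 2) * f x ^ m) :
    AntitoneOn (scaledPower k m f) D := by
  intro x hx y hy hxy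
  have := sub_le_mul_sub_of_hasDerivAt_le (C := 0) hD
    (fun z hz => h.hasDerivAt_scaledPower (k := k) hI (hDI hz) (hD0 z hz))
    (fun z hz => mul_nonpos_of_nonneg_of_nonpos (Real.rpow_nonneg (hD0 z hz).le _)
      (div_nonpos_of_nonpos_of_nonneg (by linarith [hle z hz]) (sq_nonneg z))) hx hy hxy
  linarith

end IsPositiveSolutionOn

/-- No positive profile is global when `β > 0`. -/
theorem not_isPositiveSolutionOn_Ioi {N : ℕ} {m p σ α β k : ℝ} {f : ℝ → ℝ} (hN : 1 ≤ N)
    (hm : 1 < m) (hp0 : 0 < p) (hp1 : p < 1) (hk0 : 0 < k) (hk : k * m = k + 2)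
    (hσ : σ = k * (1 - p)) (hβ : 0 < β) (hα : α = k * β) (hf0 : 0 < f 0)
    (hcont : ContinuousWithinAt f (Ici 0) 0) :
    ¬ IsPositiveSolutionOn N m p σ α β f (Ioi 0) := by
  intro h
  have hI : IsOpen (Ioi (0 : ℝ)) := isOpen_Ioi
  have hN' : (1 : ℝ) ≤ N := by exact_mod_cast hN
  obtain ⟨c, hc, hcle⟩ := (h.mono (J := Ioo 0 1) Ioo_subset_Ioi_self).exists_mul_deriv_le one_pos
    hk0 hf0 hcont
  have hc0 := hc.1
  have hpos : ∀ x ∈ Ici c, 0 < x := fun x hx => hc0.trans_le hx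
  have hDI : Ici c ⊆ Ioi 0 := hpos
  have hle : ∀ x ∈ Ici c, x * deriv (fun s => f s ^ m) x ≤ (k + 2) * f x ^ m :=
    fun x hx => h.mul_deriv_le_of_Icc_subset hI hN hm hk0 hk hα hc0 hx
      (fun z hz => hc0.trans_le hz.1) hcle
  have hanti := h.antitoneOn_scaledPower (k := k) hI (convex_Ici c) hDI hpos hle
  set ψ := scaledPower k m f with hψ
  set H := scaledFlux N k m β f with hH
  have hψpos : ∀ x ∈ Ici c, 0 < ψ x := fun x hx => h.scaledPower_pos (hDI hx) (hpos x hx)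
  have hHanti : StrictAntiOn H (Ici c) := by
    refine strictAntiOn_of_deriv_neg (convex_Ici c) (fun x hx => (h.hasDerivAt_scaledFlux hI hα
      (hDI hx) (hpos x hx)).continuousAt.continuousWithinAt) fun x hx => ?_
    have hx' := interior_subset hx
    have hx0 := hpos x hx'
    have hfx := h.pos (hDI hx')
    rw [(h.hasDerivAt_scaledFlux hI hα (hDI hx') hx0).deriv]
    refine mul_neg_of_pos_of_neg (Real.rpow_pos_of_pos hx0 _) ?_
    have h1 := mul_pos (Real.rpow_pos_of_pos hx0 σ) (Real.rpow_pos_of_pos hfx p)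
    have h2 : 0 < (k + 2) * (k + N) * (f x ^ m / x ^ 2) := by positivity
    linarith
  -- pass to the logarithmic variable
  have hexp : ∀ s ∈ Ici (Real.log c), Real.exp s ∈ Ici c := fun s hs =>
    (Real.log_le_iff_le_exp hc0).1 hs
  have hHnonneg : ∀ x ∈ Ici c, 0 ≤ H x := by
    intro x hx
    by_contra! hneg
    have hx0 := hpos x hx
    have hmem : ∀ s ∈ Ici (Real.log x), Real.exp s ∈ Ici x := fun s hs =>
      (Real.log_le_iff_le_exp hx0).1 hs
    -- Since `dψ/ds ≤ H ≤ H(x) < 0` from `x` on, `ψ` would have to reach zero by this `y`.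
    set y := Real.log x + ψ x / (-H x) with hy
    have hyx : Real.log x ≤ y := by
      have : 0 ≤ ψ x / (-H x) := div_nonneg (hψpos x hx).le (by linarith)
      linarith
    have key := sub_le_mul_sub_of_hasDerivAt_le (h := fun s => ψ (Real.exp s)) (C := H x)
      (convex_Ici (Real.log x))
      (fun s hs => (h.hasDerivAt_scaledPower (k := k) hI (Real.exp_pos s)
        (Real.exp_pos s)).comp s (Real.hasDerivAt_exp s))
      (fun s hs => ?_) (x := Real.log x) (y := y) self_mem_Ici hyx hyx
    · simp only [Real.exp_log hx0] at key
      have h1 : H x * (y - Real.log x) = -ψ x := by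
        rw [hy]
        have : H x ≠ 0 := hneg.ne
        field_simp
        ring
      have h2 := hψpos _ (Ici_subset_Ici.2 hx (hmem y hyx))
      linarith
    · have hs' := hmem s hs
      have h1 : H (Real.exp s) ≤ H x := hHanti.antitoneOn hx (Ici_subset_Ici.2 hx hs') hs'
      refine le_trans ?_ h1
      have hz0 := Real.exp_pos s
      generalize Real.exp s = z at hz0
      have hfz := h.pos (x := z) hz0
      simp only [hH, scaledFlux]
      rw [← rpow_neg_sub_one_mul_self hz0 k]
      have hz1 : 0 < z ^ (-k - 1) := Real.rpow_pos_of_pos hz0 _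
      have h3 : 0 ≤ z ^ (-k - 1) * z * ((2 * k + 2 + N) * (f z ^ m / z ^ 2) + β * f z) := by
        positivity
      have h4 : z ^ (-k - 1) * ((z * deriv (fun s => f s ^ m) z - (k + 2) * f z ^ m) / z ^ 2) * z
          = z ^ (-k - 1) * z * (deriv (fun s => f s ^ m) z / z - (k + 2) * (f z ^ m / z ^ 2)) := by
        field_simp
      rw [h4]
      linarith
  have hHpos : ∀ x ∈ Ici c, 0 < H x := fun x hx =>
    (hHnonneg (x + 1) (by simp only [mem_Ici] at hx ⊢; linarith)).trans_lt
      (hHanti hx (by simp only [mem_Ici] at hx ⊢; linarith) (by linarith))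
  set M := ψ c with hM
  have hM0 : 0 < M := hψpos c self_mem_Ici
  -- From `dψ/ds ≤ 0` and `ψ = ψ^((m-1)/m) φ ≤ M^((m-1)/m) φ`.
  set C : ℝ := (2 * k + 2 + N) * M ^ ((m - 1) / m) + β with hC
  have hC0 : 0 < C := by positivity
  have hm0 : 0 < m := by linarith
  have hHle : ∀ x ∈ Ici c, H x ≤ C * (x ^ (-k) * f x) := by
    intro x hx
    have hx0 := hpos x hx
    have hfx := h.pos (hDI hx)
    have hφ : 0 < x ^ (-k) * f x := mul_pos (Real.rpow_pos_of_pos hx0 _) hfx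
    have hψφ : ψ x = (x ^ (-k) * f x) ^ m := scaledPower_eq_rpow hk hx0 hfx
    have h1 : ψ x ≤ M ^ ((m - 1) / m) * (x ^ (-k) * f x) := by
      have e1 : ψ x = (ψ x) ^ ((m - 1) / m) * (x ^ (-k) * f x) := by
        rw [hψφ, ← Real.rpow_mul hφ.le, ← Real.rpow_add_one hφ.ne']
        congr 1
        field_simp
        ring
      rw [e1]
      refine mul_le_mul_of_nonneg_right ?_ hφ.le
      exact Real.rpow_le_rpow (hψpos x hx).le (hanti self_mem_Ici hx hx)
        (div_nonneg (by linarith) hm0.le)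
    have h2 : H x ≤ (2 * k + 2 + N) * ψ x + β * (x ^ (-k) * f x) := by
      have h3 : deriv (fun s => f s ^ m) x / x ≤ (k + 2) * (f x ^ m / x ^ 2) := by
        have := hle x hx
        rw [div_le_iff₀ hx0]
        have e : (k + 2) * (f x ^ m / x ^ 2) * x = (k + 2) * f x ^ m / x := by field_simp
        rw [e, le_div_iff₀ hx0]
        linarith
      have h4 := mul_le_mul_of_nonneg_left h3 (Real.rpow_nonneg hx0.le (-k))
      simp only [hH, hψ, scaledFlux, scaledPower]
      linarith
    have h5 := mul_le_mul_of_nonneg_left h1 (by positivity : (0 : ℝ) ≤ 2 * k + 2 + N)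
    rw [hC]
    linarith
  have hCp : 0 < C ^ p := Real.rpow_pos_of_pos hC0 p
  have key : ∀ y ∈ Ici (Real.log c),
      (1 - p) * (1 / C ^ p) * (y - Real.log c) ≤ H (Real.exp (Real.log c)) ^ (1 - p) := by
    intro y hy
    refine mul_sub_le_rpow_of_hasDerivAt_le (G := fun s => H (Real.exp s))
      (convex_Ici (Real.log c)) hp1
      (fun s hs => hHpos _ (hexp s hs))
      (fun s hs => (h.hasDerivAt_scaledFlux hI hα (Real.exp_pos s)
        (Real.exp_pos s)).comp s (Real.hasDerivAt_exp s))
      (fun s hs => ?_) self_mem_Ici hy hy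
    have hz := hexp s hs
    have hz0 := Real.exp_pos s
    generalize Real.exp s = z at hz hz0
    have hfz := h.pos (hDI hz)
    have hφ : 0 < z ^ (-k) * f z := mul_pos (Real.rpow_pos_of_pos hz0 _) hfz
    have h1 : H z ^ p ≤ C ^ p * (z ^ (-k) * f z) ^ p := by
      rw [← Real.mul_rpow hC0.le hφ.le]
      exact Real.rpow_le_rpow (hHpos z hz).le (hHle z hz) hp0.le
    -- This is where `σ = k (1-p)` enters: the scaled reaction term is exactly `φ^p`.
    have h2 : (z ^ (-k) * f z) ^ p = z ^ (-k) * (z ^ σ * f z ^ p) := by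
      rw [Real.mul_rpow (Real.rpow_nonneg hz0.le _) hfz.le, ← Real.rpow_mul hz0.le, ← mul_assoc,
        ← Real.rpow_add hz0, hσ]
      congr 2
      ring
    have h3 : 1 / C ^ p * H z ^ p ≤ z ^ (-k) * (z ^ σ * f z ^ p) := by
      rw [← h2, one_div, inv_mul_le_iff₀ hCp]
      exact h1
    have h4 : 0 ≤ z ^ (-k) * ((k + 2) * (k + N) * (f z ^ m / z ^ 2)) := by
      have := Real.rpow_pos_of_pos hz0 (-k)
      positivity
    have e : z ^ (-k - 1) * (-(z ^ σ * f z ^ p) - (k + 2) * (k + N) * (f z ^ m / z ^ 2)) * z =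
        z ^ (-k) * (-(z ^ σ * f z ^ p) - (k + 2) * (k + N) * (f z ^ m / z ^ 2)) := by
      rw [← rpow_neg_sub_one_mul_self hz0 k]; ring
    rw [e]
    linarith
  set B := H (Real.exp (Real.log c)) ^ (1 - p) with hB
  have hA : 0 < (1 - p) * (1 / C ^ p) := mul_pos (by linarith) (by positivity)
  have hBpos : 0 < B := Real.rpow_pos_of_pos (hHpos _ (hexp _ self_mem_Ici)) _
  have := key (Real.log c + (B + 1) / ((1 - p) * (1 / C ^ p))) (by
    have : 0 ≤ (B + 1) / ((1 - p) * (1 / C ^ p)) := by positivity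
    simp only [mem_Ici]; linarith)
  rw [add_sub_cancel_left, mul_div_cancel₀ _ hA.ne'] at this
  linarith

/-! ### Continuation of positive solutions -/

/-- Gluing two functions at a point where values and derivatives match. -/
theorem hasDerivAt_ite_lt {u u' v : ℝ → ℝ} {a b d : ℝ} (hab : a < b)
    (hu : ∀ t ∈ Ioo a b, HasDerivAt u (u' t) t) (hlim : Tendsto u (𝓝[<] b) (𝓝 (v b)))
    (hlim' : Tendsto u' (𝓝[<] b) (𝓝 d)) (hv : HasDerivAt v d b) :
    HasDerivAt (fun t => if t < b then u t else v t) d b := by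
  have hd : ∀ t ∈ Ioo a b, HasDerivAt (fun t => if t < b then u t else v t) (u' t) t := by
    intro t ht
    refine (hu t ht).congr_of_eventuallyEq ?_
    filter_upwards [Iio_mem_nhds ht.2] with s hs
    exact if_pos hs
  have hleft : HasDerivWithinAt (fun t => if t < b then u t else v t) d (Iic b) b := by
    refine hasDerivWithinAt_Iic_of_tendsto_deriv (s := Ioo a b)
      (fun t ht => (hd t ht).differentiableAt.differentiableWithinAt) ?_
      (Ioo_mem_nhdsLT hab) ?_
    · have h1 : Tendsto (fun t => if t < b then u t else v t) (𝓝[Ioo a b] b) (𝓝 (v b)) := by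
        refine (hlim.mono_left (nhdsWithin_mono b Ioo_subset_Iio_self)).congr' ?_
        filter_upwards [self_mem_nhdsWithin] with s hs
        exact (if_pos hs.2).symm
      simpa [ContinuousWithinAt] using h1
    · refine hlim'.congr' ?_
      filter_upwards [Ioo_mem_nhdsLT hab] with s hs
      exact (hd s hs).deriv.symm
  have hright : HasDerivWithinAt (fun t => if t < b then u t else v t) d (Ici b) b :=
    hv.hasDerivWithinAt.congr (fun t ht => if_neg (not_lt.2 ht)) (if_neg (lt_irrefl b))
  have := hleft.union hright
  rwa [Iic_union_Ici, hasDerivWithinAt_univ] at this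

/-- The second derivative of `y = f^m` prescribed by the profile equation, as a function of
`(ξ, y, y')`. -/
noncomputable def profileField (N : ℕ) (m p σ α β : ℝ) (q : ℝ × ℝ × ℝ) : ℝ :=
  α * q.2.1 ^ (1 / m) - β * q.1 * (1 / m * q.2.1 ^ (1 / m - 1) * q.2.2)
    - q.1 ^ σ * (q.2.1 ^ (1 / m)) ^ p - ((N : ℝ) - 1) / q.1 * q.2.2

theorem contDiffAt_profileField {N : ℕ} {m p σ α β : ℝ} {q : ℝ × ℝ × ℝ} (h1 : 0 < q.1)
    (h2 : 0 < q.2.1) : ContDiffAt ℝ 1 (profileField N m p σ α β) q := by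
  have c1 : ContDiffAt ℝ 1 (fun q : ℝ × ℝ × ℝ => q.1) q := contDiffAt_fst
  have c2 : ContDiffAt ℝ 1 (fun q : ℝ × ℝ × ℝ => q.2.1) q := contDiffAt_snd.fst
  have c3 : ContDiffAt ℝ 1 (fun q : ℝ × ℝ × ℝ => q.2.2) q := contDiffAt_snd.snd
  have c4 : ContDiffAt ℝ 1 (fun q : ℝ × ℝ × ℝ => q.2.1 ^ (1 / m)) q := c2.rpow_const_of_ne h2.ne'
  exact (((contDiffAt_const.mul c4).sub ((contDiffAt_const.mul c1).mul
    ((contDiffAt_const.mul (c2.rpow_const_of_ne h2.ne')).mul c3))).sub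
    ((c1.rpow_const_of_ne h1.ne').mul (c4.rpow_const_of_ne (Real.rpow_pos_of_pos h2 _).ne'))).sub
    ((contDiffAt_const.div c1 h1.ne').mul c3)

/-- Along a positive solution, `y = f^m` solves the first-order system of `profileField`. -/
theorem IsPositiveSolutionOn.deriv_deriv_rpow {N : ℕ} {m p σ α β : ℝ} {f : ℝ → ℝ} {I : Set ℝ}
    (h : IsPositiveSolutionOn N m p σ α β f I) (hI : IsOpen I) (hm : 0 < m) {x : ℝ} (hx : x ∈ I) :
    deriv (deriv fun s => f s ^ m) x =
      profileField N m p σ α β (x, f x ^ m, deriv (fun s => f s ^ m) x) := by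
  have hfx := h.pos hx
  have ode := h.2.2 x hx
  have e1 : (f x ^ m) ^ (1 / m) = f x := by
    rw [one_div]; exact Real.rpow_rpow_inv hfx.le hm.ne'
  have e2 : 1 / m * (f x ^ m) ^ (1 / m - 1) * (m * f x ^ (m - 1) * deriv f x) = deriv f x := by
    have : (f x ^ m) ^ (1 / m - 1) * f x ^ (m - 1) = 1 := by
      rw [← Real.rpow_mul hfx.le, ← Real.rpow_add hfx]
      have : m * (1 / m - 1) + (m - 1) = 0 := by field_simp; ring
      rw [this, Real.rpow_zero]
    calc _ = (1 / m * m) * ((f x ^ m) ^ (1 / m - 1) * f x ^ (m - 1)) * deriv f x := by ring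
      _ = deriv f x := by rw [this, one_div, inv_mul_cancel₀ hm.ne']; ring
  have e3 : 1 / m * (f x ^ m) ^ (1 / m - 1) * deriv (fun s => f s ^ m) x = deriv f x := by
    rw [h.deriv_rpow hI hx, e2]
  simp only [profileField]
  rw [e1, e3]
  linarith

/-- A solution of the first-order system of `profileField` gives a positive solution. -/
theorem isPositiveSolutionOn_of_hasDerivAt {N : ℕ} {m p σ α β : ℝ} {g W Z : ℝ → ℝ} {J : Set ℝ}
    (hJ : IsOpen J) (hJ0 : ∀ t ∈ J, 0 < t) (hm : 0 < m) (hWpos : ∀ t ∈ J, 0 < W t)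
    (hW : ∀ t ∈ J, HasDerivAt W (Z t) t)
    (hZ : ∀ t ∈ J, HasDerivAt Z (profileField N m p σ α β (t, W t, Z t)) t)
    (hg : ∀ t ∈ J, g t = W t ^ (1 / m)) : IsPositiveSolutionOn N m p σ α β g J := by
  have hdZ : ∀ t ∈ J, deriv Z t = profileField N m p σ α β (t, W t, Z t) :=
    fun t ht => (hZ t ht).deriv
  have hcZ : ContDiffOn ℝ 1 Z J := by
    rw [show (1 : WithTop ℕ∞) = 0 + 1 by norm_num, contDiffOn_succ_iff_deriv_of_isOpen hJ]
    refine ⟨fun t ht => (hZ t ht).differentiableAt.differentiableWithinAt, by simp, ?_⟩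
    rw [contDiffOn_zero]
    refine ContinuousOn.congr (fun t ht => ?_) hdZ
    have h1 : ContinuousAt (fun t => (t, W t, Z t)) t :=
      continuousAt_id.prodMk ((hW t ht).continuousAt.prodMk (hZ t ht).continuousAt)
    exact (ContinuousAt.comp (f := fun t => (t, W t, Z t))
      (contDiffAt_profileField (q := (t, W t, Z t)) (hJ0 t ht) (hWpos t ht)).continuousAt
      h1).continuousWithinAt
  have hcW : ContDiffOn ℝ 2 W J := by
    rw [show (2 : WithTop ℕ∞) = 1 + 1 by norm_num, contDiffOn_succ_iff_deriv_of_isOpen hJ]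
    exact ⟨fun t ht => (hW t ht).differentiableAt.differentiableWithinAt, by simp,
      hcZ.congr fun t ht => (hW t ht).deriv⟩
  have hpow : ∀ t ∈ J, g t ^ m = W t := fun t ht => by
    rw [hg t ht, one_div]; exact Real.rpow_inv_rpow (hWpos t ht).le hm.ne'
  refine ⟨?_, fun t ht => by rw [hg t ht]; exact Real.rpow_pos_of_pos (hWpos t ht) _,
    fun t ht => ?_⟩
  · refine ContDiffOn.congr (fun t ht => ?_) hg
    exact (hcW t ht).rpow_const_of_ne (hWpos t ht).ne'
  · have hJt := hJ.mem_nhds ht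
    have hev : (fun s => g s ^ m) =ᶠ[𝓝 t] W := by
      filter_upwards [hJt] with s hs using hpow s hs
    have hevd : deriv (fun s => g s ^ m) =ᶠ[𝓝 t] Z := by
      refine hev.deriv.trans ?_
      filter_upwards [hJt] with s hs using (hW s hs).deriv
    have hevg : g =ᶠ[𝓝 t] fun s => W s ^ (1 / m) := by
      filter_upwards [hJt] with s hs using hg s hs
    have hdg : deriv g t = Z t * (1 / m) * W t ^ (1 / m - 1) := by
      rw [hevg.deriv_eq]
      exact ((hW t ht).rpow_const (Or.inl (hWpos t ht).ne')).deriv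
    rw [hevd.deriv_eq, hevd.eq_of_nhds, hdg, hdZ t ht, hg t ht]
    simp only [profileField]
    ring

/-- A positive solution on `(0, b)` for which `f^m` has a positive limit and `(f^m)'` a finite
limit at `b` can be continued as a positive solution. -/
theorem IsPositiveSolutionOn.exists_extension {N : ℕ} {m p σ α β : ℝ} {f : ℝ → ℝ} {b w₀ l : ℝ}
    (hb : 0 < b) (hm : 0 < m) (h : IsPositiveSolutionOn N m p σ α β f (Ioo 0 b)) (hw₀ : 0 < w₀)
    (hw : Tendsto (fun s => f s ^ m) (𝓝[<] b) (𝓝 w₀))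
    (hw' : Tendsto (deriv fun s => f s ^ m) (𝓝[<] b) (𝓝 l)) :
    ∃ (g : ℝ → ℝ) (b' : ℝ), b < b' ∧ EqOn g f (Ioo 0 b) ∧
      IsPositiveSolutionOn N m p σ α β g (Ioo 0 b') := by
  have hI : IsOpen (Ioo (0 : ℝ) b) := isOpen_Ioo
  set Φ := profileField N m p σ α β with hΦ
  have hΦc : ContDiffAt ℝ 1 Φ (b, w₀, l) := contDiffAt_profileField hb hw₀
  -- Adjoining `ξ` as a first coordinate makes the system autonomous, so the local existence theorem
  -- for time-independent fields applies.
  have hV : ContDiffAt ℝ 1 (fun q : ℝ × ℝ × ℝ => ((1 : ℝ), q.2.2, Φ q)) (b, w₀, l) :=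
    contDiffAt_const.prodMk (contDiffAt_snd.snd.prodMk hΦc)
  obtain ⟨γ, hγb, ε, hε, hγ⟩ :=
    hV.exists_forall_mem_closedBall_exists_eq_forall_mem_Ioo_hasDerivAt₀ b
  have hbmem : b ∈ Ioo (b - ε) (b + ε) := ⟨by linarith, by linarith⟩
  have hγ1 : ∀ t ∈ Ioo (b - ε) (b + ε), HasDerivAt (fun t => (γ t).1) 1 t := fun t ht =>
    (ContinuousLinearMap.fst ℝ ℝ (ℝ × ℝ)).hasFDerivAt.comp_hasDerivAt t (hγ t ht)
  have hγ2 : ∀ t ∈ Ioo (b - ε) (b + ε), HasDerivAt (fun t => (γ t).2.1) (γ t).2.2 t :=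
    fun t ht => ((ContinuousLinearMap.fst ℝ ℝ ℝ).comp
      (ContinuousLinearMap.snd ℝ ℝ (ℝ × ℝ))).hasFDerivAt.comp_hasDerivAt t (hγ t ht)
  have hγ3 : ∀ t ∈ Ioo (b - ε) (b + ε), HasDerivAt (fun t => (γ t).2.2) (Φ (γ t)) t :=
    fun t ht => ((ContinuousLinearMap.snd ℝ ℝ ℝ).comp
      (ContinuousLinearMap.snd ℝ ℝ (ℝ × ℝ))).hasFDerivAt.comp_hasDerivAt t (hγ t ht)
  have htime : ∀ t ∈ Ico b (b + ε), (γ t).1 = t := by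
    intro t ht
    have ht' : t ∈ Ioo (b - ε) (b + ε) := ⟨by linarith [ht.1], ht.2⟩
    have h1 := sub_le_mul_sub_of_hasDerivAt_le (convex_Ioo _ _) hγ1 (fun _ _ => le_refl (1 : ℝ))
      hbmem ht' ht.1
    have h2 := mul_sub_le_sub_of_le_hasDerivAt (convex_Ioo _ _) hγ1 (fun _ _ => le_refl (1 : ℝ))
      hbmem ht' ht.1
    rw [hγb] at h1 h2
    linarith
  obtain ⟨δ, hδ, hδpos⟩ : ∃ δ > 0, ∀ t, |t - b| < δ → 0 < (γ t).2.1 := by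
    have := (hγ2 b hbmem).continuousAt.eventually_const_lt (u := 0)
      (by simpa only [hγb] using hw₀)
    exact Metric.eventually_nhds_iff.1 this
  set b' := b + min ε δ with hb'
  have hbb' : b < b' := by
    have := lt_min hε hδ
    linarith
  have hlt : ∀ t, b ≤ t → t < b' → t ∈ Ico b (b + ε) ∧ 0 < (γ t).2.1 := by
    intro t h1 h2
    refine ⟨⟨h1, h2.trans_le (by rw [hb']; linarith [min_le_left ε δ])⟩, hδpos t ?_⟩
    rw [abs_of_nonneg (by linarith)]
    linarith [min_le_right ε δ]
  -- The old solution is kept to the left of `b` and the local one used from `b` on, so no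
  -- uniqueness is needed; only values and derivatives must match at `b`.
  set W : ℝ → ℝ := fun t => if t < b then f t ^ m else (γ t).2.1 with hWdef
  set Z : ℝ → ℝ := fun t => if t < b then deriv (fun s => f s ^ m) t else (γ t).2.2 with hZdef
  have hWl : ∀ t, t < b → W t = f t ^ m := fun t ht => if_pos ht
  have hWr : ∀ t, b ≤ t → W t = (γ t).2.1 := fun t ht => if_neg (not_lt.2 ht)
  have hZl : ∀ t, t < b → Z t = deriv (fun s => f s ^ m) t := fun t ht => if_pos ht
  have hZr : ∀ t, b ≤ t → Z t = (γ t).2.2 := fun t ht => if_neg (not_lt.2 ht)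
  have hγeq : ∀ t, b ≤ t → t < b' → γ t = (t, W t, Z t) := fun t h1 h2 => by
    rw [hWr t h1, hZr t h1]
    exact Prod.ext (htime t (hlt t h1 h2).1) rfl
  refine ⟨fun t => if t < b then f t else (γ t).2.1 ^ (1 / m), b', hbb',
    fun t ht => if_pos ht.2, ?_⟩
  refine isPositiveSolutionOn_of_hasDerivAt (W := W) (Z := Z) isOpen_Ioo (fun t ht => ht.1) hm
    (fun t ht => ?_) (fun t ht => ?_) (fun t ht => ?_) (fun t ht => ?_)
  · rcases lt_or_ge t b with htb | htb
    · rw [hWl t htb]; exact Real.rpow_pos_of_pos (h.pos ⟨ht.1, htb⟩) _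
    · rw [hWr t htb]; exact (hlt t htb ht.2).2
  · rcases lt_trichotomy t b with htb | rfl | htb
    · rw [hZl t htb]
      refine (h.hasDerivAt_rpow hI ⟨ht.1, htb⟩).congr_of_eventuallyEq ?_
      filter_upwards [Iio_mem_nhds htb] with s hs using hWl s hs
    · rw [hZr t le_rfl]
      refine hasDerivAt_ite_lt hb (fun s hs => h.hasDerivAt_rpow hI hs) ?_ ?_ (hγ2 t hbmem)
      · rw [hγb]; exact hw
      · rw [hγb]; exact hw'
    · have h1 := (hlt t htb.le ht.2).1
      rw [hZr t htb.le]
      refine (hγ2 t ⟨by linarith, h1.2⟩).congr_of_eventuallyEq ?_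
      filter_upwards [Ioi_mem_nhds htb] with s hs using hWr s (le_of_lt hs)
  · rcases lt_trichotomy t b with htb | rfl | htb
    · have h1 := h.deriv_deriv_rpow hI hm ⟨ht.1, htb⟩
      rw [hWl t htb, hZl t htb, ← h1]
      refine (h.hasDerivAt_deriv_rpow hI ⟨ht.1, htb⟩).congr_of_eventuallyEq ?_
      filter_upwards [Iio_mem_nhds htb] with s hs using hZl s hs
    · rw [← hΦ, ← hγeq t le_rfl hbb']
      refine hasDerivAt_ite_lt hb (fun s hs => h.hasDerivAt_deriv_rpow hI hs) ?_ ?_ (hγ3 t hbmem)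
      · rw [hγb]; exact hw'
      · rw [hγb]
        have hid : Tendsto (fun s : ℝ => s) (𝓝[<] t) (𝓝 t) :=
          tendsto_id.mono_left nhdsWithin_le_nhds
        refine (hΦc.continuousAt.tendsto.comp
          (hid.prodMk_nhds (hw.prodMk_nhds hw'))).congr' ?_
        filter_upwards [Ioo_mem_nhdsLT hb] with s hs
        exact (h.deriv_deriv_rpow hI hm hs).symm
    · have h1 := (hlt t htb.le ht.2).1
      rw [← hΦ, ← hγeq t htb.le ht.2]
      refine (hγ3 t ⟨by linarith, h1.2⟩).congr_of_eventuallyEq ?_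
      filter_upwards [Ioi_mem_nhds htb] with s hs using hZr s (le_of_lt hs)
  · rcases lt_or_ge t b with htb | htb
    · simp only [if_pos htb]
      rw [hWl t htb, one_div]
      exact (Real.rpow_rpow_inv (h.pos ⟨ht.1, htb⟩).le hm.ne').symm
    · simp only [if_neg (not_lt.2 htb)]
      rw [hWr t htb]

/-! ### Behaviour of maximal profiles at the end of their interval -/

theorem tendsto_of_tendsto_rpow {f : ℝ → ℝ} {m b w₀ : ℝ} (hm : 0 < m) (hb : 0 < b)
    (hpos : ∀ x ∈ Ioo 0 b, 0 < f x) (hw : Tendsto (fun s => f s ^ m) (𝓝[<] b) (𝓝 w₀)) :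
    Tendsto f (𝓝[<] b) (𝓝 (w₀ ^ m⁻¹)) := by
  refine (hw.rpow_const (p := m⁻¹) (Or.inr (by positivity))).congr' ?_
  filter_upwards [Ioo_mem_nhdsLT hb] with x hx
  exact Real.rpow_rpow_inv (hpos x hx).le hm.ne'

/-- If `f^m` reaches zero at `b` with negative slope then `f` changes sign at `b`. -/
theorem changesSignAt_of_tendsto_deriv {m b l : ℝ} {f : ℝ → ℝ} (hm : 1 < m) (hb : 0 < b)
    (hpos : ∀ x ∈ Ioo 0 b, 0 < f x)
    (hd : ∀ x ∈ Ioo 0 b, HasDerivAt (fun s => f s ^ m) (deriv (fun s => f s ^ m) x) x)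
    (hw : Tendsto (fun s => f s ^ m) (𝓝[<] b) (𝓝 0))
    (hw' : Tendsto (deriv fun s => f s ^ m) (𝓝[<] b) (𝓝 l)) (hl : l < 0) :
    ChangesSignAt m f b := by
  have hm0 : 0 < m := by linarith
  have hf : Tendsto f (𝓝[<] b) (𝓝 0) := by
    have := tendsto_of_tendsto_rpow hm0 hb hpos hw
    rwa [Real.zero_rpow (by positivity)] at this
  have hslope : Tendsto (fun t => f t ^ m / (t - b)) (𝓝[<] b) (𝓝 l) := by
    -- Continuing `f^m` linearly with slope `l` converts the limit of the derivative into a limit of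
    -- difference quotients.
    have h1 : HasDerivAt (fun t => if t < b then f t ^ m else l * (t - b)) l b := by
      refine hasDerivAt_ite_lt (v := fun t => l * (t - b)) hb hd (by simpa using hw) hw' ?_
      simpa using ((hasDerivAt_id b).sub_const b).const_mul l
    have h2 := (hasDerivAt_iff_tendsto_slope.1 h1).mono_left
      (nhdsWithin_mono b (fun t (ht : t < b) => ht.ne))
    refine h2.congr' ?_
    filter_upwards [self_mem_nhdsWithin] with t ht
    simp only [slope_def_field, if_pos (mem_Iio.1 ht), lt_irrefl, if_false, sub_self, mul_zero,
      sub_zero]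
  refine ⟨hpos, hf, ⟨l, hl, hw'⟩, ⟨(-l) ^ (1 / m), Real.rpow_pos_of_pos (by linarith) _, ?_⟩, ?_⟩
  · rw [Asymptotics.isEquivalent_iff_tendsto_one]
    · have h1 : Tendsto (fun t => (f t ^ m / (t - b) / l) ^ (1 / m)) (𝓝[<] b) (𝓝 1) := by
        have := (hslope.div_const l).rpow_const (p := 1 / m) (Or.inr (by positivity))
        rwa [div_self hl.ne, Real.one_rpow] at this
      refine h1.congr' ?_
      filter_upwards [Ioo_mem_nhdsLT hb] with t ht
      have hft := hpos t ht
      have hbt : 0 < b - t := sub_pos.2 ht.2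
      have e : f t ^ m / (t - b) / l = f t ^ m / ((-l) * (b - t)) := by
        rw [div_div]; congr 1; ring
      have hl' : 0 ≤ -l := by linarith
      rw [Pi.div_apply, e, Real.div_rpow (Real.rpow_nonneg hft.le _) (mul_nonneg hl' hbt.le),
        Real.mul_rpow hl' hbt.le, ← Real.rpow_mul hft.le, mul_one_div_cancel hm0.ne',
        Real.rpow_one]
    · filter_upwards [self_mem_nhdsWithin] with t ht
      exact (mul_pos (Real.rpow_pos_of_pos (by linarith) _)
        (Real.rpow_pos_of_pos (sub_pos.2 ht) _)).ne'
  · intro F hF hdiff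
    -- `V` equals `f^m` on the left, which forces `V b = 0` and `V' b = l < 0`; hence `V < 0` just
    -- after `b`, where `F` has the sign of `V`.
    set V : ℝ → ℝ := fun ξ => |F ξ| ^ (m - 1) * F ξ with hV
    have hVeq : ∀ t ∈ Ioo 0 b, V t = f t ^ m := by
      intro t ht
      have hft := hpos t ht
      simp only [hV, hF ht]
      rw [abs_of_pos hft, ← Real.rpow_add_one hft.ne', sub_add_cancel]
    have hVev : ∀ᶠ t in 𝓝[<] b, V t = f t ^ m := by
      filter_upwards [Ioo_mem_nhdsLT hb] with t ht using hVeq t ht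
    have hVb : V b = 0 := tendsto_nhds_unique
      (hdiff.continuousAt.tendsto.mono_left nhdsWithin_le_nhds)
      (hw.congr' (hVev.mono fun t ht => ht.symm))
    have hVs := hasDerivAt_iff_tendsto_slope.1 hdiff.hasDerivAt
    have hleft : Tendsto (slope V b) (𝓝[<] b) (𝓝 (deriv V b)) :=
      hVs.mono_left (nhdsWithin_mono b (fun t (ht : t < b) => ht.ne))
    have hderiv : deriv V b = l := by
      refine tendsto_nhds_unique hleft (hslope.congr' ?_)
      filter_upwards [hVev] with t ht
      rw [slope_def_field, hVb, sub_zero, ht]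
    rw [hderiv] at hVs
    have hright : Tendsto (slope V b) (𝓝[>] b) (𝓝 l) :=
      hVs.mono_left (nhdsWithin_mono b (fun t (ht : b < t) => ht.ne'))
    filter_upwards [hright.eventually_lt_const hl, self_mem_nhdsWithin] with t ht htb
    rw [slope_def_field, hVb, sub_zero, div_lt_iff₀ (sub_pos.2 htb), zero_mul] at ht
    by_contra! hcon
    exact absurd ht (not_lt.2 (mul_nonneg (Real.rpow_nonneg (abs_nonneg _) _) hcon))

/-- On a bounded interval, `f^m` and `(f^m)'` have finite limits at the right end. -/
theorem IsPositiveSolutionOn.exists_tendsto_rpow {N : ℕ} {m p σ α β k : ℝ} {f : ℝ → ℝ} {b : ℝ}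
    (hN : 1 ≤ N) (hm : 1 < m) (hp0 : 0 < p) (hσ : 0 ≤ σ) (hk0 : 0 < k) (hk : k * m = k + 2)
    (hα : α = k * β) (hb : 0 < b) (h : IsPositiveSolutionOn N m p σ α β f (Ioo 0 b))
    (hf0 : 0 < f 0) (hcont : ContinuousWithinAt f (Ici 0) 0) :
    ∃ w₀ l : ℝ, 0 ≤ w₀ ∧ b * l ≤ (k + 2) * w₀ ∧ Tendsto (fun s => f s ^ m) (𝓝[<] b) (𝓝 w₀) ∧
      Tendsto (deriv fun s => f s ^ m) (𝓝[<] b) (𝓝 l) := by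
  have hI : IsOpen (Ioo (0 : ℝ) b) := isOpen_Ioo
  have hm0 : 0 < m := by linarith
  have hN' : (0 : ℝ) ≤ (N : ℝ) - 1 := by
    have : (1 : ℝ) ≤ N := by exact_mod_cast hN
    linarith
  obtain ⟨c, hc, hcle⟩ := h.exists_mul_deriv_le hb hk0 hf0 hcont
  have hc0 := hc.1
  have hDI : Ico c b ⊆ Ioo 0 b := fun z hz => ⟨hc0.trans_le hz.1, hz.2⟩
  have hle : ∀ x ∈ Ico c b, x * deriv (fun s => f s ^ m) x ≤ (k + 2) * f x ^ m :=
    fun x hx => h.mul_deriv_le_of_Icc_subset hI hN hm hk0 hk hα hc0 hx.1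
      (fun z hz => ⟨hc0.trans_le hz.1, hz.2.trans_lt hx.2⟩) hcle
  have hanti := h.antitoneOn_scaledPower (k := k) hI (convex_Ico c b) hDI
    (fun x hx => (hDI hx).1) hle
  have hcb : (Ioo c b).Nonempty := nonempty_Ioo.2 hc.2
  obtain ⟨ψ₀, hψ⟩ : ∃ ψ₀, Tendsto (scaledPower k m f) (𝓝[<] b) (𝓝 ψ₀) :=
    ⟨_, (hanti.mono Ioo_subset_Ico_self).tendsto_nhdsWithin_Ioo_left hcb ⟨0, by
      rintro _ ⟨x, hx, rfl⟩
      exact (h.scaledPower_pos (hDI (Ioo_subset_Ico_self hx))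
        (hDI (Ioo_subset_Ico_self hx)).1).le⟩⟩
  have hid : Tendsto (fun s : ℝ => s) (𝓝[<] b) (𝓝 b) := tendsto_id.mono_left nhdsWithin_le_nhds
  set w₀ := b ^ k * b ^ 2 * ψ₀ with hw₀def
  have hw : Tendsto (fun s => f s ^ m) (𝓝[<] b) (𝓝 w₀) := by
    refine (((hid.rpow_const (p := k) (Or.inl hb.ne')).mul (hid.pow 2)).mul hψ).congr' ?_
    filter_upwards [Ioo_mem_nhdsLT hb] with x hx
    have hx0 := hx.1
    have h1 : x ^ k * x ^ (-k) = 1 := by rw [← Real.rpow_add hx0]; simp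
    simp only [scaledPower]
    calc x ^ k * x ^ 2 * (x ^ (-k) * (f x ^ m / x ^ 2))
        = (x ^ k * x ^ (-k)) * (x ^ 2 * (f x ^ m / x ^ 2)) := by ring
      _ = f x ^ m := by rw [h1, one_mul, mul_div_cancel₀ _ (by positivity)]
  have hw₀ : 0 ≤ w₀ := by
    refine ge_of_tendsto hw ?_
    filter_upwards [Ioo_mem_nhdsLT hb] with x hx using Real.rpow_nonneg (h.pos hx).le _
  have hf := tendsto_of_tendsto_rpow hm0 hb (fun x hx => h.pos hx) hw
  -- the flux has a bounded derivative
  obtain ⟨M, hM⟩ : ∃ M, ∀ᶠ x in 𝓝[<] b, f x < M := ⟨_, hf.eventually_lt_const (lt_add_one _)⟩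
  obtain ⟨a, hca, hab, ha⟩ := hM.exists_Ioo_nhdsLT hc.2
  have ha0 : 0 < a := hc0.trans_le hca
  have hsub : Ioo a b ⊆ Ioo 0 b := Ioo_subset_Ioo_left ha0.le
  obtain ⟨L, hL⟩ := exists_tendsto_nhdsLT_of_hasDerivAt_bounded hab
    (fun x hx => h.hasDerivAt_profileFlux hI (hsub hx) (hsub hx).1)
    (K := |α + β| * M + b ^ σ * M ^ p + ((N : ℝ) - 1) / a ^ 2 * M ^ m) (fun x hx => by
      have hx0 := (hsub hx).1
      have hfx := h.pos (hsub hx)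
      have hfM := (ha x hx).le
      have h1 : |(α + β) * f x| ≤ |α + β| * M := by
        rw [abs_mul, abs_of_pos hfx]
        exact mul_le_mul_of_nonneg_left hfM (abs_nonneg _)
      have h2 : |x ^ σ * f x ^ p| ≤ b ^ σ * M ^ p := by
        rw [abs_of_nonneg (mul_nonneg (Real.rpow_nonneg hx0.le _) (Real.rpow_nonneg hfx.le _))]
        exact mul_le_mul (Real.rpow_le_rpow hx0.le hx.2.le hσ)
          (Real.rpow_le_rpow hfx.le hfM hp0.le) (Real.rpow_nonneg hfx.le _)
          (Real.rpow_nonneg hb.le _)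
      have h3 : |((N : ℝ) - 1) / x ^ 2 * f x ^ m| ≤ ((N : ℝ) - 1) / a ^ 2 * M ^ m := by
        rw [abs_of_nonneg (mul_nonneg (div_nonneg hN' (sq_nonneg x)) (Real.rpow_nonneg hfx.le _))]
        exact mul_le_mul (div_le_div_of_nonneg_left hN' (by positivity)
          (pow_le_pow_left₀ ha0.le hx.1.le 2)) (Real.rpow_le_rpow hfx.le hfM hm0.le)
          (Real.rpow_nonneg hfx.le _) (by positivity)
      exact (abs_sub _ _).trans (add_le_add ((abs_sub _ _).trans (add_le_add h1 h2)) h3))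
  have hw' : Tendsto (deriv fun s => f s ^ m) (𝓝[<] b)
      (𝓝 (L - ((N : ℝ) - 1) / b * w₀ - β * b * w₀ ^ m⁻¹)) := by
    refine ((hL.sub ((tendsto_const_nhds.div hid hb.ne').mul hw)).sub
      ((hid.const_mul β).mul hf)).congr fun x => ?_
    simp only [profileFlux, Pi.div_apply]
    ring
  refine ⟨w₀, _, hw₀, ?_, hw, hw'⟩
  -- The inequality `ξ w' ≤ (k+2) w` survives in the limit; it yields `l ≤ 0` when `w₀ = 0`.
  refine le_of_tendsto_of_tendsto (hid.mul hw') (hw.const_mul (k + 2)) ?_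
  filter_upwards [Ioo_mem_nhdsLT hc.2] with x hx using hle x (Ioo_subset_Ico_self hx)

theorem openInterval_coe (b : ℝ) : openInterval (b : EReal) = Ioo 0 b := by
  ext x; simp [openInterval]

theorem openInterval_top : openInterval ⊤ = Ioi 0 := by
  ext x; simp [openInterval]

/-- Every maximal profile with `α > 0` changes sign at the finite end of its interval. -/
theorem IsMaximalProfile.exists_changesSignAt {N : ℕ} {m p σ α β k : ℝ} {f : ℝ → ℝ} {R : EReal}
    (hN : 1 ≤ N) (hm : 1 < m) (hp0 : 0 < p) (hp1 : p < 1) (hmp : m + p < 2) (hk0 : 0 < k)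
    (hk : k * m = k + 2) (hσ : σ = k * (1 - p)) (hβ : 0 < β) (hα : α = k * β)
    (hmax : IsMaximalProfile N m p σ α β f R) :
    ∃ b : ℝ, 0 < b ∧ R = (b : EReal) ∧ ChangesSignAt m f b := by
  obtain ⟨hR, ⟨hf0, hflat⟩, h, hext⟩ := hmax
  have hcont := hflat.continuousWithinAt
  have hσ0 : 0 ≤ σ := by
    rw [hσ]; exact mul_nonneg hk0.le (by linarith)
  induction R with
  | bot => simp at hR
  | top =>
    rw [openInterval_top] at h
    exact absurd h
      (not_isPositiveSolutionOn_Ioi hN hm hp0 hp1 hk0 hk hσ hβ hα hf0 hcont)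
  | coe b =>
    have hb : 0 < b := by exact_mod_cast hR
    refine ⟨b, hb, rfl, ?_⟩
    rw [openInterval_coe] at h hext
    obtain ⟨w₀, l, hw₀, hl, hw, hw'⟩ :=
      h.exists_tendsto_rpow hN hm hp0 hσ0 hk0 hk hα hb hf0 hcont
    have hw₀0 : w₀ = 0 := by
      by_contra hne
      obtain ⟨g, b', hbb', hgf, hg⟩ := h.exists_extension hb (by linarith)
        (lt_of_le_of_ne hw₀ (Ne.symm hne)) hw hw'
      refine hext g (b' : EReal) (by exact_mod_cast hbb') hgf ?_
      rwa [openInterval_coe]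
    subst hw₀0
    have hf : Tendsto f (𝓝[<] b) (𝓝 0) := by
      have := tendsto_of_tendsto_rpow (by linarith) hb (fun x hx => h.pos hx) hw
      rwa [Real.zero_rpow (inv_ne_zero (by linarith))] at this
    have hl0 : l < 0 := by
      rw [mul_zero] at hl
      refine lt_of_le_of_ne (nonpos_of_mul_nonpos_right hl hb) fun hl0 => ?_
      subst hl0
      exact h.false_of_tendsto_zero_of_frequently hN hm hp0 hp1 hσ0 hmp hb hf fun ε hε =>
        (hw'.eventually_const_lt (by linarith)).frequently
    exact changesSignAt_of_tendsto_deriv hm hb (fun x hx => h.pos hx)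
      (fun x hx => h.hasDerivAt_rpow isOpen_Ioo hx) hw hw' hl0

/-! ### The three statements, with the self-similar exponent `k = 2/(m-1)` -/

theorem theorem1p3 (N : ℕ) (hN : 1 ≤ N) (m p σ : ℝ) (hm : 1 < m) (hp0 : 0 < p) (hp1 : p < 1)
    (hσ : σ = 2 * (1 - p) / (m - 1)) (hmp : m + p < 2) :
    (∀ α β : ℝ, α = 2 / (m - 1) * β →
      ¬ ∃ f : ℝ → ℝ, IsGoodProfile N m p σ α β f) ∧
    (¬ ∃ u : EuclideanSpace ℝ (Fin N) → ℝ → ℝ, IsEternalSolutionWithInterface N m p σ u) ∧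
    (∀ α β : ℝ, 0 < α → α = 2 / (m - 1) * β →
      ∀ (f : ℝ → ℝ) (R : EReal), IsMaximalProfile N m p σ α β f R →
        ∃ ξ₀ : ℝ, 0 < ξ₀ ∧ R = (ξ₀ : EReal) ∧ ChangesSignAt m f ξ₀) := by
  have hm1 : 0 < m - 1 := by linarith
  have hσ0 : 0 ≤ σ := by
    rw [hσ]; exact div_nonneg (by linarith) hm1.le
  refine ⟨fun α β _ ⟨f, hf⟩ => not_isGoodProfile hN hm hp0 hp1 hσ0 hmp α β f hf,
    fun ⟨u, hu⟩ => not_isEternalSolutionWithInterface hN hm hp0 hp1 hσ0 hmp u hu,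
    fun α β hα hαβ f R hmax => ?_⟩
  have hk0 : 0 < 2 / (m - 1) := div_pos two_pos hm1
  have hβ : 0 < β := by
    rw [hαβ] at hα
    exact pos_of_mul_pos_right hα hk0.le
  refine hmax.exists_changesSignAt (k := 2 / (m - 1)) hN hm hp0 hp1 hmp hk0 ?_ ?_ hβ hαβ
  · field_simp
    ring
  · rw [hσ]; ring
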